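/- A convex polytope $P\subset\mathbb R^3$ (the convex hull of finitely many points) is said to tile $\mathbb R^3$ at level $k$ (to $k$-tile) with a discrete multiset $\Lambda\subset\mathbb R^3$, where $k$ is a positive integer, if $$\sum_{\lambda\in\Lambda}\mathbf 1_{P+\lambda}(x)=k\qquad\text{for almost every }x\in\mathbb R^3 ,$$ points of $\Lambda$ being counted with multiplicity; discrete means that every bounded set contains only finitely many points of $\Lambda$. A $4$-legged frame $(\mathbf e,\boldsymbol\tau_1,\boldsymbol\tau_2)$ of $P$ consists of four different edges of $P$ of the form $$E,\quad E+\boldsymbol\tau_1,\quad E+\boldsymbol\tau_2,\quad E+\boldsymbol\tau_1+\boldsymbol\tau_2,$$ where $E=[\mathbf a,\mathbf a+\mathbf e]$ is a segment with direction vector $\mathbf e$, such that $P$ is centrally symmetric, the edges $E$ and $E+\boldsymbol\tau_1$ lie on a common facet $F$ of $P$, and the edges $E+\boldsymbol\tau_2$ and $E+\boldsymbol\tau_1+\boldsymbol\tau_2$ lie on the opposite facet $F^-$, the image of $F$ under reflection in the centre of $P$. Write $\mathbf x^\perp=\{\mathbf y\in\mathbb R^3:\langle \mathbf x,\mathbf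 y\rangle=0\}$ and $\delta_\Lambda=\sum_{\lambda\in\Lambda}\delta_\lambda$. **Corollary.** Let $P\subset\mathbb R^3$ be a convex polytope that $k$-tiles $\mathbb R^3$ with a discrete multiset $\Lambda$, $k\ge 1$, and suppose that $P$ has the intersection property $$\bigcap_{(\mathbf e,\boldsymbol\tau_1,\boldsymbol\tau_2)}\left(\mathbf e^\perp\cup\boldsymbol\tau_1^\perp\cup\boldsymbol\tau_2^\perp\right)=\{0\},$$ where the intersection is over all $4$-legged frames of $P$ (and is all of $\mathbb R^3$ if there are none). Then $\delta_\Lambda$ is a tempered measure, so that its Fourier transform $\widehat{\delta_\Lambda}$ is defined as a tempered distribution, and $S=\operatorname{supp}\widehat{\delta_\Lambda}$ is a discrete set of bounded density: there is a finite constant $M$ such that $\#(S\cap B_R(x))\le M\,|B_R(x)|$ for all $x\in\mathbb R^3$ and all $R>1$. -/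

import Mathlib

open MeasureTheory SchwartzMap
open scoped FourierTransform ENNReal NNReal Pointwise

namespace MultiTiling

/-- The Euclidean space `ℝ³`. -/
abbrev R3 : Type := EuclideanSpace ℝ (Fin 3)

/-- A convex polytope: the convex hull of finitely many points. (Non-empty interior is not
required here; it is automatic for a set that tiles at a positive level.) -/
def IsConvexPolytope (P : Set R3) : Prop :=
  ∃ s : Finset R3, P = convexHull ℝ (s : Set R3)

/-- A multiset of points of `ℝ³` is given by its multiplicity function `Λ : ℝ³ → ℕ`. It is
discrete if every bounded region contains only finitely many of its points. -/
def IsDiscreteMultiset (Λ : R3 → ℕ) : Prop :=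
  ∀ r : ℝ, (Function.support Λ ∩ Metric.ball 0 r).Finite

/-- `P` tiles `ℝ³` at level `k` when translated by the multiset `Λ`: for almost every `x`,
`∑_{lam ∈ Λ} 1_{P + lam}(x) = k`. The sum is taken in `[0, ∞]`, so it is never a junk value. -/
def TilesAtLevel (k : ℕ) (P : Set R3) (Λ : R3 → ℕ) : Prop :=
  ∀ᵐ x : R3, ∑' lam : R3, (Λ lam : ℝ≥0∞) * (lam +ᵥ P).indicator (fun _ => (1 : ℝ≥0∞)) x = k

/-- The measure `δ_Λ = ∑_{lam ∈ Λ} δ_lam` (with multiplicities). -/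
noncomputable def deltaMeasure (Λ : R3 → ℕ) : Measure R3 :=
  Measure.sum fun lam : R3 => (Λ lam : ℝ≥0∞) • Measure.dirac lam

/-- The support (in the sense of distributions) of the Fourier transform of the tempered distribution
`δ_Λ`, defined when the measure `δ_Λ` has temperate growth. -/
noncomputable def fourierSupport (Λ : R3 → ℕ) [(deltaMeasure Λ).HasTemperateGrowth] : Set R3 :=
  Distribution.dsupport (𝓕 (deltaMeasure Λ).toTemperedDistribution : 𝓢'(R3, ℂ))

/-- `F` is a `d`-dimensional face of the convex polytope `P`: the non-empty set of maximizers over `P` of a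
linear functional, with affine hull of dimension `d`. For `d = 1` this is an edge, and for `d = 2`
(with `P` three-dimensional) a facet. -/
def IsFaceOfDim (P F : Set R3) (d : ℕ) : Prop :=
  F.Nonempty ∧ IsExposed ℝ P F ∧ Module.finrank ℝ (vectorSpan ℝ F) = d

/-- The edges `[a, a + e]`, `[a, a + e] + τ₁`, `[a, a + e] + τ₂`, `[a, a + e] + τ₁ + τ₂`, for some
base point `a`, are the legs of a 4-legged frame of the centrally symmetric polytope `P`: they are
four different edges of `P`, the first two lie on a facet `F` of `P`, and the last two lie on the
opposite facet, which is the image of `F` under the reflection in the centre `c` of `P`.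
Opposite facets of a three-dimensional polytope are disjoint, so `τ₁ ≠ 0` is all that is needed
for the four edges to be different. -/
def IsFourLeggedFrame (P : Set R3) (e τ₁ τ₂ : R3) : Prop :=
  ∃ (c a : R3) (F : Set R3),
    Equiv.pointReflection c '' P = P ∧
    IsFaceOfDim P F 2 ∧
    τ₁ ≠ 0 ∧
    IsFaceOfDim P (segment ℝ a (a + e)) 1 ∧
    IsFaceOfDim P (segment ℝ (a + τ₁) (a + τ₁ + e)) 1 ∧
    IsFaceOfDim P (segment ℝ (a + τ₂) (a + τ₂ + e)) 1 ∧
    IsFaceOfDim P (segment ℝ (a + τ₁ + τ₂) (a + τ₁ + τ₂ + e)) 1 ∧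
    segment ℝ a (a + e) ⊆ F ∧
    segment ℝ (a + τ₁) (a + τ₁ + e) ⊆ F ∧
    segment ℝ (a + τ₂) (a + τ₂ + e) ⊆ Equiv.pointReflection c '' F ∧
    segment ℝ (a + τ₁ + τ₂) (a + τ₁ + τ₂ + e) ⊆ Equiv.pointReflection c '' F

/-- The hyperplane `x^⊥`, as a set. -/
def perp (x : R3) : Set R3 := {y | inner ℝ x y = 0}

/-- The intersection property: over all 4-legged frames `(e, τ₁, τ₂)` of `P`, the sets
`e^⊥ ∪ τ₁^⊥ ∪ τ₂^⊥` meet only in the origin. -/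
def IntersectionProperty (P : Set R3) : Prop :=
  (⋂ (e : R3) (τ₁ : R3) (τ₂ : R3) (_ : IsFourLeggedFrame P e τ₁ τ₂),
    (perp e ∪ perp τ₁ ∪ perp τ₂)) = {0}

/-- A set has (uniformly) bounded density if, for some finite `M`, `#(S ∩ B_R(x)) ≤ M |B_R(x)|`
for all `x` and all `R > 1`. The count is an extended natural number. -/
def HasBoundedDensity (S : Set R3) : Prop :=
  ∃ M : ℝ≥0, ∀ (x : R3) (R : ℝ), 1 < R →
    ((S ∩ Metric.ball x R).encard : ℝ≥0∞) ≤ (M : ℝ≥0∞) * volume (Metric.ball x R)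

end MultiTiling

/-!
The tiling condition is turned into difference equations for the multiplicity function `Λ`, and
these confine the support of the Fourier transform of `δ_Λ` to families of parallel planes.

*Difference equations.* Let `w₁, w₂, w₃` be a basis. Displacing a point by `t₁ w₁ + t₂ w₂ + t₃ w₃`
with `t₁ ≫ t₂ ≫ t₃ > 0` infinitely small (the filter `germ [w₁, w₂, w₃]`) leads, for suitable
arbitrarily small values, outside the exceptional null set of the tiling, so that every point,
without exception, is covered exactly `k` times after the displacement
(`TilesAtLevel.sum_germIndicator`). Hence every difference of two such displaced indicator
functions of `P` is annihilated by convolution with `δ_Λ`. Now let `(e, τ₁, τ₂)` be a four-legged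
frame, `n` a normal of its facet `F`, and `m` a vector orthogonal to `e` and `n`. Differencing in
the last, infinitely smallest direction `± n` leaves the indicator functions of the two faces of
`P` that are extreme in the directions `n` and `-n`, namely `F` and `F⁻`, and the same happens
with `± m` within these faces, and with `± e` within the resulting edges
(`germIndicator_append_neg_sub`). Thus the triple difference of the indicator function of `P` over
`± e, ± m, ± n` is a signed sum of unit masses at the eight endpoints of the legs. By central
symmetry the signs are those of a triple difference with steps `e, τ₁, τ₂`, and the three backward
differences together annihilate `Λ` (`IsFourLeggedFrame.backwardDiff_eq_zero`).

*Temperate growth.* Since `P` contains a ball, `δ_Λ` has mass at most `k` on every ball of some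
fixed radius (`TilesAtLevel.exists_deltaMeasure_ball_le`).

*Support.* On the Fourier side the difference equation says that the Fourier transform of `δ_Λ` is
killed by the product of the factors `1 - e^{-2πi⟨v, ξ⟩}`, where `v` runs over `e, τ₁, τ₂`; so at
each point `ξ` of the support one of `⟨e, ξ⟩`, `⟨τ₁, ξ⟩`, `⟨τ₂, ξ⟩` is an integer
(`exists_int_of_mem_fourierSupport`).

*Density.* By compactness of the sphere, the intersection property holds already for finitely many
frames. Selecting one vector from each of them gives finitely many families of vectors without
common orthogonal direction, and the points having integer inner products with all the vectors of
such a family are uniformly separated (`hasBoundedDensity_of_inner_int`).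
-/

open Filter Topology

namespace MultiTiling

/-! ### Infinitesimal displacements along a flag of directions -/

section Germ

variable {E : Type*} [NormedAddCommGroup E] [InnerProductSpace ℝ E]

/-- The filter of infinitesimal displacements `t₁ w₁ + ⋯ + tⱼ wⱼ` along a list of directions, where
`tᵢ > 0` and each `tᵢ` is infinitely small compared with the preceding ones: a property holds
eventually if it holds for all small `t₁`, then for all small `t₂` (how small may depend on `t₁`),
and so on. -/
noncomputable def germ : List E → Filter E
  | [] => pure 0
  | w :: ws => (𝓝[>] (0 : ℝ)).bind fun t => (germ ws).map (t • w + ·)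

lemma eventually_germ_nil {p : E → Prop} : (∀ᶠ v in germ ([] : List E), p v) ↔ p 0 := by
  simp [germ]

lemma eventually_germ_cons {w : E} {ws : List E} {p : E → Prop} :
    (∀ᶠ v in germ (w :: ws), p v) ↔
      ∀ᶠ t in 𝓝[>] (0 : ℝ), ∀ᶠ v in germ ws, p (t • w + v) := by
  simp [germ, eventually_bind]

lemma eventually_germ_append {ws : List E} {u : E} {p : E → Prop} :
    (∀ᶠ v in germ (ws ++ [u]), p v) ↔
      ∀ᶠ v in germ ws, ∀ᶠ t in 𝓝[>] (0 : ℝ), p (v + t • u) := by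
  induction ws generalizing p with
  | nil => simp [eventually_germ_cons, eventually_germ_nil]
  | cons w ws ih => simp only [List.cons_append, eventually_germ_cons, ih, add_assoc]

instance germ_neBot (ws : List E) : NeBot (germ ws) := by
  induction ws with
  | nil => rw [germ]; infer_instance
  | cons w ws ih =>
    refine ⟨fun h => ?_⟩
    have h1 : ∀ᶠ v in germ (w :: ws), False := by rw [h]; exact eventually_bot
    rw [eventually_germ_cons] at h1
    obtain ⟨t, ht⟩ := h1.exists
    exact ht.exists.elim fun _ h => h

lemma germ_le_nhds (ws : List E) : germ ws ≤ 𝓝 (0 : E) := by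
  suffices H : ∀ p : E → Prop, (∀ᶠ v in 𝓝 (0 : E), p v) → ∀ᶠ v in germ ws, p v from
    fun s hs => H (· ∈ s) hs
  induction ws with
  | nil => exact fun p hp => eventually_germ_nil.2 hp.self_of_nhds
  | cons w ws ih =>
    intro p hp
    rw [eventually_germ_cons]
    have h1 : Tendsto (fun t : ℝ => t • w) (𝓝[>] 0) (𝓝 0) :=
      ((continuous_id.smul continuous_const).tendsto' 0 0 (by simp)).mono_left
        nhdsWithin_le_nhds
    filter_upwards [h1.eventually (eventually_eventually_nhds.2 hp)] with t ht
    refine ih _ ?_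
    exact ((continuous_const.add continuous_id).tendsto' (0 : E) (t • w) (by simp)).eventually ht

lemma eventually_germ_mem_span (ws : List E) :
    ∀ᶠ v in germ ws, v ∈ Submodule.span ℝ {w | w ∈ ws} := by
  induction ws with
  | nil => simp [eventually_germ_nil]
  | cons w ws ih =>
    rw [eventually_germ_cons]
    refine Eventually.of_forall fun t => ih.mono fun v hv => ?_
    refine Submodule.add_mem _ (Submodule.smul_mem _ _ (Submodule.subset_span (by simp))) ?_
    exact Submodule.span_mono (fun x hx => by simp_all) hv

/-- A convex set is decided by an infinitesimal displacement along a flag. -/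
lemma germ_dichotomy {A : Set E} (hA : Convex ℝ A) (ws : List E) (y : E) :
    (∀ᶠ v in germ ws, y + v ∈ A) ∨ ∀ᶠ v in germ ws, y + v ∉ A := by
  induction ws generalizing y with
  | nil => simpa [eventually_germ_nil] using em _
  | cons w ws ih =>
    simp only [eventually_germ_cons]
    by_cases h : ∃ᶠ t in 𝓝[>] (0 : ℝ), ∀ᶠ v in germ ws, y + (t • w + v) ∈ A
    · left
      obtain ⟨t₀, h₀, ht₀⟩ := (h.and_eventually self_mem_nhdsWithin).exists
      filter_upwards [Ioo_mem_nhdsGT ht₀] with t ht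
      obtain ⟨t₁, h₁, ht₁⟩ := (h.and_eventually (Ioo_mem_nhdsGT ht.1)).exists
      filter_upwards [h₀, h₁] with v hv₀ hv₁
      have hd : 0 < t₀ - t₁ := by linarith [ht.2, ht₁.2]
      have := hA hv₁ hv₀ (div_nonneg (sub_nonneg.2 ht.2.le) hd.le)
        (div_nonneg (sub_nonneg.2 ht₁.2.le) hd.le) (by field_simp; ring)
      convert this using 1
      have e : t = (t₀ - t) / (t₀ - t₁) * t₁ + (t - t₁) / (t₀ - t₁) * t₀ := by
        field_simp; ring
      have e1 : (t - t₁) / (t₀ - t₁) = 1 - (t₀ - t) / (t₀ - t₁) := by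
        field_simp; ring
      rw [e1] at e ⊢
      nth_rewrite 1 [e]
      module
    · right
      rw [not_frequently] at h
      refine h.mono fun t ht => ?_
      have := (ih (y + t • w)).resolve_left (by simpa [add_assoc] using ht)
      simpa [add_assoc] using this

/-- If a convex set contains the infinitesimal displacements of `y` along a flag, then it contains
them in its algebraic interior relative to the span of the flag. -/
lemma eventually_germ_interior {A : Set E} (hA : Convex ℝ A) (ws : List E) (y : E)
    (h : ∀ᶠ v in germ ws, y + v ∈ A) :
    ∀ᶠ v in germ ws, ∀ z ∈ Submodule.span ℝ {w | w ∈ ws},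
      ∀ᶠ s in 𝓝[>] (0 : ℝ), y + v + s • z ∈ A := by
  induction ws generalizing y with
  | nil =>
    rw [eventually_germ_nil] at h ⊢
    intro z hz
    have : z = 0 := by simpa using hz
    simpa [this] using h
  | cons w ws ih =>
    rw [eventually_germ_cons] at h ⊢
    have half : Tendsto (fun t : ℝ => t / 2) (𝓝[>] 0) (𝓝[>] 0) := by
      refine tendsto_nhdsWithin_iff.2 ⟨?_, ?_⟩
      · exact ((continuous_id.div_const 2).tendsto' 0 0 (by simp)).mono_left nhdsWithin_le_nhds
      · filter_upwards [self_mem_nhdsWithin] with t ht using half_pos (Set.mem_Ioi.1 ht)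
    have dbl : Tendsto (fun t : ℝ => 2 * t) (𝓝[>] 0) (𝓝[>] 0) := by
      refine tendsto_nhdsWithin_iff.2 ⟨?_, ?_⟩
      · exact ((continuous_const.mul continuous_id).tendsto' 0 0 (by simp)).mono_left
          nhdsWithin_le_nhds
      · filter_upwards [self_mem_nhdsWithin] with t ht
        exact mul_pos two_pos (Set.mem_Ioi.1 ht)
    filter_upwards [half.eventually h, dbl.eventually h, self_mem_nhdsWithin] with t h₁ h₂ ht
    have ht : 0 < t := ht
    have i₁ := ih (y + (t / 2) • w) (h₁.mono fun v hv => by rwa [add_assoc])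
    have i₂ := ih (y + (2 * t) • w) (h₂.mono fun v hv => by rwa [add_assoc])
    filter_upwards [i₁, i₂] with v hv₁ hv₂ z hz
    have hset : {x | x ∈ w :: ws} = insert w {x | x ∈ ws} := by ext; simp
    rw [hset] at hz
    obtain ⟨b, z', hz', rfl⟩ := Submodule.mem_span_insert.1 hz
    have hT : Tendsto (fun s : ℝ => t + s * b) (𝓝[>] 0) (𝓝 t) :=
      (Continuous.tendsto' (by fun_prop) 0 t (by simp)).mono_left nhdsWithin_le_nhds
    have hI : Set.Ioo (t / 2) (2 * t) ∈ 𝓝 t := Ioo_mem_nhds (by linarith) (by linarith)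
    filter_upwards [hv₁ z' hz', hv₂ z' hz', hT.eventually hI] with s a₁ a₂ hs
    set r := t + s * b with hr
    have hd : 0 < 2 * t - t / 2 := by linarith
    have := hA a₁ a₂ (div_nonneg (sub_nonneg.2 hs.2.le) hd.le)
      (div_nonneg (sub_nonneg.2 hs.1.le) hd.le) (by field_simp; ring)
    convert this using 1
    have e : r = (2 * t - r) / (2 * t - t / 2) * (t / 2)
        + (r - t / 2) / (2 * t - t / 2) * (2 * t) := by
      field_simp; ring
    have e1 : (r - t / 2) / (2 * t - t / 2) = 1 - (2 * t - r) / (2 * t - t / 2) := by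
      field_simp; ring
    rw [e1] at e ⊢
    have e2 : y + (t • w + v) + s • (b • w + z') = y + v + s • z' + r • w := by
      rw [hr]; module
    rw [e2]
    nth_rewrite 1 [e]
    module

/-- If a convex set `C` contains the infinitesimal displacements of `y` along a flag, and also a
point on the positive side (as measured by `u`) of the plane swept out by the flag, then it contains
the displacements extended by the direction `u`. -/
lemma eventually_germ_append_of_convex {C : Set E} (hC : Convex ℝ C) {ws : List E}
    {u y z : E} {α : ℝ} (h : ∀ᶠ v in germ ws, y + v ∈ C) (hα : 0 < α)
    (hz : z ∈ Submodule.span ℝ {w | w ∈ ws}) (hp : y + z + α • u ∈ C) : ∀ᶠ v in germ (ws ++ [u]), y + v ∈ C := by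
  rw [eventually_germ_append]
  filter_upwards [eventually_germ_interior hC ws y h, eventually_germ_mem_span ws]
    with v hv hvs
  -- `y + v + t u` is a convex combination of `y + z + α u` and a point of `C` near `y + v`.
  have hs : Tendsto (fun t : ℝ => t / (α - t)) (𝓝[>] 0) (𝓝[>] 0) := by
    refine tendsto_nhdsWithin_iff.2 ⟨?_, ?_⟩
    · have : ContinuousAt (fun t : ℝ => t / (α - t)) 0 :=
        ContinuousAt.div (by fun_prop) (by fun_prop) (by simpa using hα.ne')
      have h0 := this.tendsto
      simp only [zero_div] at h0
      exact h0.mono_left nhdsWithin_le_nhds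
    · filter_upwards [Ioo_mem_nhdsGT hα] with t ht using div_pos ht.1 (sub_pos.2 ht.2)
  filter_upwards [hs.eventually (hv (v - z) (Submodule.sub_mem _ hvs hz)), Ioo_mem_nhdsGT hα]
    with t ht htα
  have hd : 0 < α - t := sub_pos.2 htα.2
  have := hC hp ht (div_nonneg htα.1.le hα.le) (div_nonneg hd.le hα.le) (by field_simp; ring)
  convert this using 1
  match_scalars <;> field_simp <;> ring

open Classical in
/-- The indicator function of the points from which an infinitesimal displacement along the flag
`ws` leads into `A`. -/
noncomputable def germIndicator (ws : List E) (A : Set E) (y : E) : ℤ :=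
  if ∀ᶠ v in germ ws, y + v ∈ A then 1 else 0

lemma germIndicator_nil_singleton (a y : E) [Decidable (y = a)] :
    germIndicator [] {a} y = if y = a then 1 else 0 := by
  simp only [germIndicator, eventually_germ_nil, add_zero, Set.mem_singleton_iff]

/-- The set of maximizers of `⟨u, ·⟩` on `C`. -/
def maximizers (u : E) (C : Set E) : Set E := {x ∈ C | ∀ y ∈ C, inner ℝ u y ≤ inner ℝ u x}

lemma convex_maximizers {C : Set E} (hC : Convex ℝ C) (u : E) : Convex ℝ (maximizers u C) := by
  intro x hx y hy a b ha hb hab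
  refine ⟨hC hx.1 hy.1 ha hb hab, fun z hz => ?_⟩
  have h1 := hx.2 z hz
  have h2 := hy.2 z hz
  rw [inner_add_right, inner_smul_right, inner_smul_right]
  calc inner ℝ u z = a * inner ℝ u z + b * inner ℝ u z := by rw [← add_mul, hab, one_mul]
    _ ≤ _ := by gcongr

lemma inner_eq_zero_of_mem_span {ws : List E} {u v : E} (h : ∀ w ∈ ws, inner ℝ u w = 0)
    (hv : v ∈ Submodule.span ℝ {w | w ∈ ws}) : inner ℝ u v = 0 := by
  induction hv using Submodule.span_induction with
  | mem x hx => exact h x hx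
  | zero => simp
  | add x y _ _ hx hy => rw [inner_add_right, hx, hy, add_zero]
  | smul a x _ hx => rw [inner_smul_right, hx, mul_zero]

/-- If the displacements along `ws` followed by `-u` stay in `C`, those followed by `u` leave it,
then the displacements along `ws` stay in the top face of `C` in the direction `u`. -/
lemma eventually_germ_maximizers {C : Set E} (hC : Convex ℝ C) (hcl : IsClosed C) {ws : List E}
    {u y : E} (hu : u ≠ 0) (horth : ∀ w ∈ ws, inner ℝ u w = 0)
    (hspan : ∀ p ∈ C, ∀ q ∈ C, ∃ z ∈ Submodule.span ℝ {w | w ∈ ws}, ∃ α : ℝ, p - q = z + α • u)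
    (h1 : ∀ᶠ v in germ (ws ++ [-u]), y + v ∈ C) (h2 : ¬ ∀ᶠ v in germ (ws ++ [u]), y + v ∈ C) :
    ∀ᶠ v in germ ws, y + v ∈ maximizers u C := by
  rw [eventually_germ_append] at h1
  have h3 : ∀ᶠ v in germ ws, y + v ∈ C := h1.mono fun v hv => by
    refine hcl.mem_of_tendsto (f := fun t : ℝ => y + (v + t • -u)) (b := 𝓝[>] 0) ?_ hv
    exact (Continuous.tendsto' (by fun_prop) 0 (y + v) (by simp)).mono_left nhdsWithin_le_nhds
  filter_upwards [h3, eventually_germ_mem_span ws] with v hv hvs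
  refine ⟨hv, fun p hp => not_lt.1 fun hlt => h2 ?_⟩
  obtain ⟨z, hz, α, hzα⟩ := hspan p hp _ hv
  refine eventually_germ_append_of_convex hC h3 (α := α) (z := v + z) ?_
    (Submodule.add_mem _ hvs hz) ?_
  · have : inner ℝ u (p - (y + v)) = α * inner ℝ u u := by
      rw [hzα, inner_add_right, inner_smul_right, inner_eq_zero_of_mem_span horth hz, zero_add]
    rw [inner_sub_right] at this
    have h4 : 0 < inner ℝ u u := real_inner_self_pos.2 hu
    by_contra hneg
    nlinarith [not_lt.1 hneg]
  · convert hp using 1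
    rw [← sub_add_cancel p (y + v), hzα]; abel

/-- The top face of `C` in the direction `u` is entered from below. -/
lemma eventually_germ_append_of_maximizers {C : Set E} (hC : Convex ℝ C) {ws : List E}
    {u y : E} (hu : u ≠ 0) (horth : ∀ w ∈ ws, inner ℝ u w = 0)
    (hspan : ∀ p ∈ C, ∀ q ∈ C, ∃ z ∈ Submodule.span ℝ {w | w ∈ ws}, ∃ α : ℝ, p - q = z + α • u)
    (hne : ∃ p ∈ C, ∃ q ∈ C, inner ℝ u p ≠ inner ℝ u q)
    (h : ∀ᶠ v in germ ws, y + v ∈ maximizers u C) :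
    (∀ᶠ v in germ (ws ++ [-u]), y + v ∈ C) ∧ ¬ ∀ᶠ v in germ (ws ++ [u]), y + v ∈ C := by
  have h4 : 0 < inner ℝ u u := real_inner_self_pos.2 hu
  constructor
  · obtain ⟨v, hv, hvs⟩ := (h.and (eventually_germ_mem_span ws)).exists
    obtain ⟨p, hp, hlt⟩ : ∃ p ∈ C, inner ℝ u p < inner ℝ u (y + v) := by
      obtain ⟨p, hp, q, hq, hpq⟩ := hne
      rcases (hv.2 p hp).lt_or_eq with h5 | h5
      · exact ⟨p, hp, h5⟩
      · exact ⟨q, hq, lt_of_le_of_ne (hv.2 q hq) fun h6 => hpq (h5.trans h6.symm)⟩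
    obtain ⟨z, hz, α, hzα⟩ := hspan p hp _ hv.1
    refine eventually_germ_append_of_convex hC (h.mono fun v hv => hv.1) (α := -α) (z := v + z) ?_
      (Submodule.add_mem _ hvs hz) ?_
    · have : inner ℝ u (p - (y + v)) = α * inner ℝ u u := by
        rw [hzα, inner_add_right, inner_smul_right, inner_eq_zero_of_mem_span horth hz, zero_add]
      rw [inner_sub_right] at this
      by_contra hneg
      nlinarith [not_lt.1 hneg]
    · convert hp using 1
      rw [← sub_add_cancel p (y + v), hzα]; module
  · intro h5
    rw [eventually_germ_append] at h5
    obtain ⟨v, hv, hv5⟩ := (h.and h5).exists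
    obtain ⟨t, ht, ht0⟩ := (hv5.and self_mem_nhdsWithin).exists
    have h6 := hv.2 _ ht
    rw [← add_assoc, inner_add_right, inner_smul_right] at h6
    nlinarith [mul_pos (show 0 < t from ht0) h4]

/-- Differencing the indicator function of a convex set `C` in a last, infinitely small direction
`± u` leaves the indicator functions of the two faces of `C` that are extreme in the directions
`u` and `-u`. -/
lemma germIndicator_append_neg_sub {C : Set E} (hC : Convex ℝ C) (hcl : IsClosed C) {ws : List E}
    {u : E} (hu : u ≠ 0) (horth : ∀ w ∈ ws, inner ℝ u w = 0)
    (hspan : ∀ p ∈ C, ∀ q ∈ C, ∃ z ∈ Submodule.span ℝ {w | w ∈ ws}, ∃ α : ℝ, p - q = z + α • u)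
    (hne : ∃ p ∈ C, ∃ q ∈ C, inner ℝ u p ≠ inner ℝ u q) (y : E) :
    germIndicator (ws ++ [-u]) C y - germIndicator (ws ++ [u]) C y =
      germIndicator ws (maximizers u C) y - germIndicator ws (maximizers (-u) C) y := by
  have horth' : ∀ w ∈ ws, inner ℝ (-u) w = 0 := fun w hw => by rw [inner_neg_left, horth w hw]; simp
  have hspan' : ∀ p ∈ C, ∀ q ∈ C, ∃ z ∈ Submodule.span ℝ {w | w ∈ ws}, ∃ α : ℝ,
      p - q = z + α • -u := fun p hp q hq => by
    obtain ⟨z, hz, α, h⟩ := hspan p hp q hq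
    exact ⟨z, hz, -α, by rw [h]; module⟩
  have hne' : ∃ p ∈ C, ∃ q ∈ C, inner ℝ (-u) p ≠ inner ℝ (-u) q := by
    obtain ⟨p, hp, q, hq, h⟩ := hne
    exact ⟨p, hp, q, hq, by simpa using h⟩
  have a1 := eventually_germ_maximizers (y := y) hC hcl hu horth hspan
  have a2 := eventually_germ_maximizers (y := y) hC hcl (neg_ne_zero.2 hu) horth' hspan'
  have b1 := eventually_germ_append_of_maximizers (y := y) hC hu horth hspan hne
  have b2 := eventually_germ_append_of_maximizers (y := y) hC (neg_ne_zero.2 hu) horth' hspan' hne'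
  rw [neg_neg] at a2 b2
  unfold germIndicator
  split_ifs <;> first | rfl | tauto

end Germ

/-! ### The tiling identity at every point, after an infinitesimal displacement -/

lemma ae_frequently_nhdsGT {p : ℝ → Prop} (h : ∀ᵐ t, p t) : ∃ᶠ t in 𝓝[>] (0 : ℝ), p t := by
  intro hc
  obtain ⟨δ, hδ, hsub⟩ := mem_nhdsGT_iff_exists_Ioo_subset.1 hc
  have h0 : volume (Set.Ioo (0 : ℝ) δ) = 0 := measure_mono_null hsub (by simpa [ae_iff] using h)
  rw [Real.volume_Ioo, sub_zero, ENNReal.ofReal_eq_zero] at h0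
  exact absurd (Set.mem_Ioi.1 hδ) (not_lt.2 h0)

/-- A property that holds almost everywhere holds frequently at infinitesimal displacements along
a flag spanning the space, by Fubini's theorem in the coordinates given by the flag. -/
lemma frequently_germ_of_ae {w₁ w₂ w₃ : R3} (hw : LinearIndependent ℝ ![w₁, w₂, w₃])
    {p : R3 → Prop} (h : ∀ᵐ x, p x) (x : R3) : ∃ᶠ v in germ [w₁, w₂, w₃], p (x + v) := by
  let f : ℝ × ℝ × ℝ →ₗ[ℝ] R3 :=
    (LinearMap.toSpanSingleton ℝ R3 w₁).coprod
      ((LinearMap.toSpanSingleton ℝ R3 w₂).coprod (LinearMap.toSpanSingleton ℝ R3 w₃))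
  have hf : ∀ t₁ t₂ t₃, f (t₁, t₂, t₃) = t₁ • w₁ + (t₂ • w₂ + t₃ • w₃) := fun t₁ t₂ t₃ => by
    simp [f]
  have hinj : Function.Injective f := by
    rw [← LinearMap.ker_eq_bot, LinearMap.ker_eq_bot']
    rintro ⟨t₁, t₂, t₃⟩ ht
    rw [hf] at ht
    have := Fintype.linearIndependent_iff.1 hw ![t₁, t₂, t₃]
      (by simpa [Fin.sum_univ_three, add_assoc] using ht)
    have h0 := this 0
    have h1 := this 1
    have h2 := this 2
    simp at h0 h1 h2
    simp [h0, h1, h2]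
  let L : (ℝ × ℝ × ℝ) ≃L[ℝ] R3 :=
    (LinearEquiv.ofInjectiveOfFinrankEq f hinj (by simp)).toContinuousLinearEquiv
  have hL : ∀ t₁ t₂ t₃, L (t₁, t₂, t₃) = t₁ • w₁ + (t₂ • w₂ + t₃ • w₃) := hf
  have hac : Measure.map L volume ≪ (volume : Measure R3) := by
    have : SigmaFinite (Measure.map L volume) :=
      L.toHomeomorph.toMeasurableEquiv.sigmaFinite_map
    have : (volume : Measure (ℝ × ℝ)).IsAddHaarMeasure := Measure.prod.instIsAddHaarMeasure _ _
    have : (volume : Measure (ℝ × ℝ × ℝ)).IsAddHaarMeasure := Measure.prod.instIsAddHaarMeasure _ _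
    have := L.isAddHaarMeasure_map volume
    exact Measure.absolutelyContinuous_isAddHaarMeasure _ _
  have hx : ∀ᵐ z : R3, p (x + z) :=
    (measurePreserving_add_left (volume : Measure R3) x).quasiMeasurePreserving.ae h
  have h1 : ∀ᵐ t : ℝ × ℝ × ℝ, p (x + L t) :=
    ae_of_ae_map L.continuous.measurable.aemeasurable (hac.ae_le hx)
  have h2 : ∀ᵐ t₁ : ℝ, ∀ᵐ t : ℝ × ℝ, p (x + L (t₁, t)) := Measure.ae_ae_of_ae_prod h1
  intro hc
  simp only [eventually_germ_cons, eventually_germ_nil] at hc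
  obtain ⟨t₁, h3, hc1⟩ := ((ae_frequently_nhdsGT h2).and_eventually hc).exists
  obtain ⟨t₂, h4, hc2⟩ :=
    ((ae_frequently_nhdsGT (Measure.ae_ae_of_ae_prod h3)).and_eventually hc1).exists
  obtain ⟨t₃, h5, hc3⟩ := ((ae_frequently_nhdsGT h4).and_eventually hc2).exists
  apply hc3
  rw [hL] at h5
  simpa using h5

lemma mem_vadd_set_iff_sub_mem {P : Set R3} {x lam : R3} : x ∈ lam +ᵥ P ↔ x - lam ∈ P := by
  rw [Set.mem_vadd_set_iff_neg_vadd_mem, vadd_eq_add, neg_add_eq_sub]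

/-- In a tiling, after an infinitesimal displacement along a flag spanning the space, every point
is covered exactly `k` times. -/
lemma TilesAtLevel.sum_germIndicator {k : ℕ} {P : Set R3} {Λ : R3 → ℕ} (hT : TilesAtLevel k P Λ)
    (hc : Convex ℝ P) {D : ℝ} (hD : P ⊆ Metric.closedBall 0 D) {w₁ w₂ w₃ : R3}
    (hw : LinearIndependent ℝ ![w₁, w₂, w₃]) (x : R3) (L : Finset R3)
    (hL : ∀ lam, Λ lam ≠ 0 → ‖x - lam‖ ≤ D + 1 → lam ∈ L) :
    ∑ lam ∈ L, (Λ lam : ℤ) * germIndicator [w₁, w₂, w₃] P (x - lam) = k := by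
  classical
  have hsmall : ∀ᶠ v in germ [w₁, w₂, w₃], ‖v‖ < 1 :=
    germ_le_nhds _ (by
      simpa [Metric.ball, dist_zero_right] using Metric.ball_mem_nhds (0 : R3) one_pos)
  have hind : ∀ lam : R3, ∀ᶠ v in germ [w₁, w₂, w₃],
      (if x + v - lam ∈ P then (1 : ℤ) else 0) = germIndicator [w₁, w₂, w₃] P (x - lam) := by
    intro lam
    have e : ∀ v, x + v - lam = x - lam + v := fun v => by abel
    simp only [e]
    rcases germ_dichotomy hc [w₁, w₂, w₃] (x - lam) with h | h
    · rw [germIndicator, if_pos h]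
      exact h.mono fun v hv => if_pos hv
    · rw [germIndicator, if_neg fun h' => ((h.and h').exists.elim fun v hv => hv.1 hv.2)]
      exact h.mono fun v hv => if_neg hv
  have hall := (eventually_all_finset L).2 fun lam _ => hind lam
  obtain ⟨v, hv, hv1, hv2⟩ :=
    ((frequently_germ_of_ae hw hT x).and_eventually (hsmall.and hall)).exists
  rw [tsum_eq_sum (s := L)] at hv
  · rw [Finset.sum_congr rfl fun lam hlam => by rw [← hv2 lam hlam]]
    have : (∑ lam ∈ L, Λ lam * (if x + v - lam ∈ P then 1 else 0) : ℕ) = k := by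
      rw [← Nat.cast_inj (R := ℝ≥0∞), ← hv]
      push_cast
      refine Finset.sum_congr rfl fun lam _ => ?_
      simp only [Set.indicator_apply, mem_vadd_set_iff_sub_mem]
    rw [← this]
    push_cast
    rfl
  · intro lam hlam
    by_cases h0 : Λ lam = 0
    · simp [h0]
    · rw [Set.indicator_of_notMem, mul_zero]
      intro hmem
      rw [mem_vadd_set_iff_sub_mem] at hmem
      refine hlam (hL lam h0 ?_)
      have h1 : ‖x + v - lam‖ ≤ D := by simpa using hD hmem
      calc ‖x - lam‖ = ‖(x + v - lam) - v‖ := by congr 1; abel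
        _ ≤ ‖x + v - lam‖ + ‖v‖ := norm_sub_le _ _
        _ ≤ D + 1 := add_le_add h1 hv1.le

/-! ### Triple differences of a tile -/

lemma IsDiscreteMultiset.countable_support {Λ : R3 → ℕ} (hΛ : IsDiscreteMultiset Λ) :
    (Function.support Λ).Countable := by
  have : Function.support Λ = ⋃ n : ℕ, Function.support Λ ∩ Metric.ball 0 n := by
    rw [← Set.inter_iUnion, Metric.iUnion_ball_nat, Set.inter_univ]
  rw [this]
  exact Set.countable_iUnion fun n => (hΛ n).countable

lemma TilesAtLevel.volume_ne_zero {k : ℕ} (hk : 0 < k) {P : Set R3} {Λ : R3 → ℕ}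
    (hΛ : IsDiscreteMultiset Λ) (hT : TilesAtLevel k P Λ) : volume P ≠ 0 := by
  intro h0
  have h1 : volume (⋃ lam ∈ Function.support Λ, (lam +ᵥ P)) = 0 := by
    rw [measure_biUnion_null_iff hΛ.countable_support]
    intro lam _
    rw [measure_vadd, h0]
  have h2 : ∀ᵐ x : R3, x ∉ ⋃ lam ∈ Function.support Λ, (lam +ᵥ P) :=
    measure_eq_zero_iff_ae_notMem.1 h1
  obtain ⟨x, hx1, hx2⟩ := (hT.and h2).exists
  rw [ENNReal.tsum_eq_zero.2] at hx1
  · exact hk.ne (by exact_mod_cast hx1)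
  · intro lam
    by_cases h : Λ lam = 0
    · simp [h]
    · rw [Set.indicator_of_notMem, mul_zero]
      exact fun hm => hx2 (Set.mem_biUnion (Function.mem_support.2 h) hm)

lemma TilesAtLevel.interior_nonempty {k : ℕ} (hk : 0 < k) {P : Set R3} {Λ : R3 → ℕ}
    (hΛ : IsDiscreteMultiset Λ) (hT : TilesAtLevel k P Λ) (hc : Convex ℝ P) (hcl : IsClosed P) :
    (interior P).Nonempty := by
  by_contra h
  apply hT.volume_ne_zero hk hΛ
  have := hc.addHaar_frontier volume
  rwa [hcl.frontier_eq, Set.not_nonempty_iff_eq_empty.1 h, Set.sdiff_empty] at this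

lemma exists_inner_ne_of_interior_nonempty {P : Set R3} (hP : (interior P).Nonempty) {n : R3}
    (hn : n ≠ 0) : ∃ p ∈ P, ∃ q ∈ P, inner ℝ n p ≠ inner ℝ n q := by
  obtain ⟨p, hp⟩ := hP
  have h1 : Tendsto (fun t : ℝ => p + t • n) (𝓝[>] 0) (𝓝 p) :=
    (Continuous.tendsto' (by fun_prop) 0 p (by simp)).mono_left nhdsWithin_le_nhds
  obtain ⟨t, ht, ht0⟩ :=
    ((h1.eventually (isOpen_interior.mem_nhds hp)).and self_mem_nhdsWithin).exists
  refine ⟨p, interior_subset hp, p + t • n, interior_subset ht, ?_⟩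
  have : 0 < inner ℝ n n := real_inner_self_pos.2 hn
  rw [inner_add_right, inner_smul_right]
  have := mul_pos (show 0 < t from ht0) this
  linarith

/-- A triple of nonzero, pairwise orthogonal vectors. -/
structure IsOrthogonalFrame (e m n : R3) : Prop where
  e_ne : e ≠ 0
  m_ne : m ≠ 0
  n_ne : n ≠ 0
  em : inner ℝ e m = 0
  en : inner ℝ e n = 0
  mn : inner ℝ m n = 0

namespace IsOrthogonalFrame

variable {e m n : R3}

lemma linearIndependent (h : IsOrthogonalFrame e m n) : LinearIndependent ℝ ![e, m, n] := by
  refine linearIndependent_of_ne_zero_of_inner_eq_zero (𝕜 := ℝ) ?_ ?_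
  · intro i
    fin_cases i
    exacts [h.e_ne, h.m_ne, h.n_ne]
  · intro i j hij
    have h1 := h.em
    have h2 := h.en
    have h3 := h.mn
    have h1' := h.em
    have h2' := h.en
    have h3' := h.mn
    rw [real_inner_comm] at h1' h2' h3'
    fin_cases i <;> fin_cases j <;> first | exact absurd rfl hij | assumption

lemma exists_coeffs (h : IsOrthogonalFrame e m n) (x : R3) :
    ∃ a b c : ℝ, x = a • e + b • m + c • n := by
  have hs := h.linearIndependent.span_eq_top_of_card_eq_finrank' (by simp)
  have hx : x ∈ Submodule.span ℝ (Set.range ![e, m, n]) := by rw [hs]; trivial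
  obtain ⟨c, rfl⟩ := (Submodule.mem_span_range_iff_exists_fun ℝ).1 hx
  exact ⟨c 0, c 1, c 2, by simp [Fin.sum_univ_three]⟩

lemma neg_e (h : IsOrthogonalFrame e m n) : IsOrthogonalFrame (-e) m n :=
  ⟨neg_ne_zero.2 h.e_ne, h.m_ne, h.n_ne, by simp [h.em], by simp [h.en], h.mn⟩

lemma neg_m (h : IsOrthogonalFrame e m n) : IsOrthogonalFrame e (-m) n :=
  ⟨h.e_ne, neg_ne_zero.2 h.m_ne, h.n_ne, by simp [h.em], h.en, by simp [h.mn]⟩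

lemma neg_n (h : IsOrthogonalFrame e m n) : IsOrthogonalFrame e m (-n) :=
  ⟨h.e_ne, h.m_ne, neg_ne_zero.2 h.n_ne, h.em, by simp [h.en], by simp [h.mn]⟩

end IsOrthogonalFrame

lemma exists_isOrthogonalFrame {e n : R3} (he : e ≠ 0) (hn : n ≠ 0) (hen : inner ℝ e n = 0) :
    ∃ m, IsOrthogonalFrame e m n := by
  have hlt : Module.finrank ℝ (Submodule.span ℝ (Set.range ![e, n])) < Module.finrank ℝ R3 := by
    refine (finrank_range_le_card (R := ℝ) ![e, n]).trans_lt ?_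
    simp
  obtain ⟨m, hm, hm0⟩ := Submodule.exists_mem_ne_zero_of_ne_bot
    (p := (Submodule.span ℝ (Set.range ![e, n]))ᗮ) fun h => by
      rw [Submodule.orthogonal_eq_bot_iff] at h
      rw [h] at hlt
      simp at hlt
  rw [Submodule.mem_orthogonal] at hm
  have h1 := hm e (Submodule.subset_span ⟨0, rfl⟩)
  have h2 := hm n (Submodule.subset_span ⟨1, rfl⟩)
  exact ⟨m, he, hm0, hn, h1, hen, by rw [real_inner_comm]; exact h2⟩

lemma sub_mem_span_of_mem_segment {a e p q : R3} (hp : p ∈ segment ℝ a (a + e))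
    (hq : q ∈ segment ℝ a (a + e)) : ∃ t : ℝ, p - q = t • e := by
  rw [segment_eq_image'] at hp hq
  obtain ⟨s, -, rfl⟩ := hp
  obtain ⟨t, -, rfl⟩ := hq
  exact ⟨s - t, by simp only [add_sub_cancel_left]; module⟩

lemma maximizers_segment {a e : R3} (he : e ≠ 0) :
    maximizers e (segment ℝ a (a + e)) = {a + e} := by
  have hpos : 0 < inner ℝ e e := real_inner_self_pos.2 he
  ext x
  simp only [maximizers, Set.mem_ofPred_eq, Set.mem_singleton_iff]
  constructor
  · rintro ⟨hx, hmax⟩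
    have h1 := hmax _ (right_mem_segment ℝ a (a + e))
    rw [segment_eq_image'] at hx
    obtain ⟨t, ht, rfl⟩ := hx
    simp only [add_sub_cancel_left, inner_add_right, inner_smul_right] at h1 ⊢
    have : t = 1 := by nlinarith [ht.2]
    rw [this, one_smul]
  · rintro rfl
    refine ⟨right_mem_segment ℝ a (a + e), fun y hy => ?_⟩
    rw [segment_eq_image'] at hy
    obtain ⟨t, ht, rfl⟩ := hy
    simp only [add_sub_cancel_left, inner_add_right, inner_smul_right]
    nlinarith [ht.2]

lemma maximizers_neg_segment {a e : R3} (he : e ≠ 0) :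
    maximizers (-e) (segment ℝ a (a + e)) = {a} := by
  have := maximizers_segment (a := a + e) (neg_ne_zero.2 he)
  rw [add_neg_cancel_right, segment_symm] at this
  exact this

/-- The two endpoints of a segment are distinguished by differencing along its direction. -/
lemma germIndicator_segment {a e : R3} (he : e ≠ 0) (y : R3) [DecidableEq R3] :
    germIndicator [-e] (segment ℝ a (a + e)) y - germIndicator [e] (segment ℝ a (a + e)) y =
      (if y = a + e then 1 else 0) - (if y = a then 1 else 0) := by
  have hcl : IsClosed (segment ℝ a (a + e)) := by
    rw [segment_eq_image']
    exact (isCompact_Icc.image (by fun_prop)).isClosed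
  have := germIndicator_append_neg_sub (convex_segment (𝕜 := ℝ) a (a + e)) hcl (ws := []) he
    (by simp) (fun p hp q hq => ?_)
    ⟨a, left_mem_segment ℝ _ _, a + e, right_mem_segment ℝ _ _, ?_⟩ y
  · rw [maximizers_segment he, maximizers_neg_segment he, germIndicator_nil_singleton,
      germIndicator_nil_singleton] at this
    exact this
  · obtain ⟨t, ht⟩ := sub_mem_span_of_mem_segment hp hq
    exact ⟨0, Submodule.zero_mem _, t, by rw [ht, zero_add]⟩
  · rw [inner_add_right]
    have : inner ℝ e e ≠ 0 := (real_inner_self_pos.2 he).ne'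
    simpa using this

/-- Differencing the indicator function of a planar convex set `F` with normal `n`, along a flag
`e`, `m` of orthogonal directions in its plane. -/
lemma germIndicator_planar {e m n : R3} (h : IsOrthogonalFrame e m n) {F : Set R3}
    (hc : Convex ℝ F) (hcl : IsClosed F) (hn : ∀ p ∈ F, ∀ q ∈ F, inner ℝ n p = inner ℝ n q)
    (hne : ∃ p ∈ F, ∃ q ∈ F, inner ℝ m p ≠ inner ℝ m q) (y : R3) :
    germIndicator [e, -m] F y - germIndicator [e, m] F y =
      germIndicator [e] (maximizers m F) y - germIndicator [e] (maximizers (-m) F) y := by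
  refine germIndicator_append_neg_sub hc hcl (ws := [e]) h.m_ne ?_ (fun p hp q hq => ?_) hne y
  · simpa using (real_inner_comm e m).trans h.em
  · obtain ⟨a, b, c, habc⟩ := h.exists_coeffs (p - q)
    refine ⟨a • e, Submodule.smul_mem _ _ (Submodule.subset_span (by simp)), b, ?_⟩
    have h1 : inner ℝ n (p - q) = 0 := by rw [inner_sub_right, hn p hp q hq, sub_self]
    rw [habc, inner_add_right, inner_add_right, inner_smul_right, inner_smul_right,
      inner_smul_right, real_inner_comm, h.en, real_inner_comm, h.mn] at h1
    have hc0 : c = 0 := by simpa [h.n_ne] using h1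
    rw [habc, hc0, zero_smul, add_zero]

lemma germIndicator_solid {e m n : R3} (h : IsOrthogonalFrame e m n) {P : Set R3}
    (hc : Convex ℝ P) (hcl : IsClosed P)
    (hne : ∃ p ∈ P, ∃ q ∈ P, inner ℝ n p ≠ inner ℝ n q) (y : R3) :
    germIndicator [e, m, -n] P y - germIndicator [e, m, n] P y =
      germIndicator [e, m] (maximizers n P) y - germIndicator [e, m] (maximizers (-n) P) y := by
  refine germIndicator_append_neg_sub hc hcl (ws := [e, m]) h.n_ne ?_ (fun p hp q hq => ?_) hne y
  · intro w hw
    simp only [List.mem_cons, List.not_mem_nil, or_false] at hw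
    rcases hw with rfl | rfl
    · rw [real_inner_comm, h.en]
    · rw [real_inner_comm, h.mn]
  · obtain ⟨a, b, c, habc⟩ := h.exists_coeffs (p - q)
    exact ⟨a • e + b • m, Submodule.add_mem _
      (Submodule.smul_mem _ _ (Submodule.subset_span (by simp)))
      (Submodule.smul_mem _ _ (Submodule.subset_span (by simp))), c, habc⟩

lemma isClosed_maximizers {C : Set R3} (hC : IsClosed C) (u : R3) : IsClosed (maximizers u C) := by
  have : maximizers u C = C ∩ ⋂ y ∈ C, {x | inner ℝ u y ≤ inner ℝ u x} := by
    ext x; simp [maximizers]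
  rw [this]
  exact hC.inter (isClosed_biInter fun y _ => isClosed_le continuous_const (by fun_prop))

lemma inner_eq_of_mem_maximizers {C : Set R3} {u p q : R3} (hp : p ∈ maximizers u C)
    (hq : q ∈ maximizers u C) : inner ℝ u p = inner ℝ u q :=
  le_antisymm (hq.2 p hp.1) (hp.2 q hq.1)

/-- The backward difference operator `f ↦ f - f(· - v)`. -/
def backwardDiff (v : R3) (f : R3 → ℤ) : R3 → ℤ := fun x => f x - f (x - v)

/-- If four edges with direction `e` are the extreme edges, in the directions `m` and `-m`, of the
faces of a tile that are extreme in the directions `n` and `-n`, then the multiset of translations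
is annihilated by a triple difference operator. -/
lemma TilesAtLevel.backwardDiff_eq_zero {k : ℕ} {P : Set R3} {Λ : R3 → ℕ}
    (hΛ : IsDiscreteMultiset Λ) (hT : TilesAtLevel k P Λ) (hc : Convex ℝ P) (hP : IsCompact P)
    {e m n a τ₁ τ₂ : R3} (h : IsOrthogonalFrame e m n)
    (hn : ∃ p ∈ P, ∃ q ∈ P, inner ℝ n p ≠ inner ℝ n q)
    (hm : ∃ p ∈ maximizers n P, ∃ q ∈ maximizers n P, inner ℝ m p ≠ inner ℝ m q)
    (hm' : ∃ p ∈ maximizers (-n) P, ∃ q ∈ maximizers (-n) P, inner ℝ m p ≠ inner ℝ m q)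
    (h₀ : maximizers m (maximizers n P) = segment ℝ a (a + e))
    (h₁ : maximizers (-m) (maximizers n P) = segment ℝ (a + τ₁) (a + τ₁ + e))
    (h₂ : maximizers m (maximizers (-n) P) = segment ℝ (a + τ₂) (a + τ₂ + e))
    (h₃ : maximizers (-m) (maximizers (-n) P) = segment ℝ (a + τ₁ + τ₂) (a + τ₁ + τ₂ + e))
    (x : R3) :
    backwardDiff e (backwardDiff τ₁ (backwardDiff τ₂ fun z => (Λ z : ℤ))) x = 0 := by
  classical
  obtain ⟨D, hD⟩ := hP.isBounded.subset_closedBall (0 : R3)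
  obtain ⟨L, hL⟩ : ∃ L : Finset R3, ∀ lam, Λ lam ≠ 0 → ‖x + a - lam‖ ≤ D + 1 → lam ∈ L := by
    refine ⟨(hΛ (‖x + a‖ + D + 2)).toFinset, fun lam h0 hle => ?_⟩
    rw [Set.Finite.mem_toFinset]
    refine ⟨h0, ?_⟩
    rw [mem_ball_zero_iff]
    calc ‖lam‖ = ‖(x + a) - (x + a - lam)‖ := by congr 1; abel
      _ ≤ ‖x + a‖ + ‖x + a - lam‖ := norm_sub_le _ _
      _ < _ := by linarith
  -- Every point `q` of `P` picks out the multiplicity of `x + a - q`.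
  have pick : ∀ q ∈ P, ∑ lam ∈ L, (Λ lam : ℤ) * (if x + a - lam = q then 1 else 0)
      = Λ (x + a - q) := by
    intro q hq
    rw [Finset.sum_eq_single (x + a - q)]
    · simp
    · intro lam _ hne
      rw [if_neg, mul_zero]
      rintro rfl
      exact hne (by abel)
    · intro hnot
      by_contra h0
      refine hnot (hL _ (fun h1 => h0 (by simp [h1])) ?_)
      have : ‖q‖ ≤ D := by simpa using hD hq
      rw [sub_sub_cancel]
      linarith
  have tile := fun {w₁ w₂ w₃ : R3} (hw : IsOrthogonalFrame w₁ w₂ w₃) =>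
    hT.sum_germIndicator hc hD hw.linearIndependent (x + a) L hL
  have hcl := hP.isClosed
  have cF := convex_maximizers hc n
  have cF' := convex_maximizers hc (-n)
  have key : ∀ y : R3,
      (germIndicator [-e, -m, -n] P y - germIndicator [-e, -m, n] P y
        - germIndicator [-e, m, -n] P y + germIndicator [-e, m, n] P y)
      - (germIndicator [e, -m, -n] P y - germIndicator [e, -m, n] P y
        - germIndicator [e, m, -n] P y + germIndicator [e, m, n] P y)
      = ((if y = a + e then 1 else 0) - (if y = a then 1 else 0))
      - ((if y = a + τ₁ + e then 1 else 0) - (if y = a + τ₁ then 1 else 0))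
      - ((if y = a + τ₂ + e then 1 else 0) - (if y = a + τ₂ then 1 else 0))
      + ((if y = a + τ₁ + τ₂ + e then 1 else 0) - (if y = a + τ₁ + τ₂ then 1 else 0)) := by
    intro y
    have s1 := germIndicator_solid h.neg_e.neg_m hc hcl hn y
    have s2 := germIndicator_solid h.neg_e hc hcl hn y
    have s3 := germIndicator_solid h.neg_m hc hcl hn y
    have s4 := germIndicator_solid h hc hcl hn y
    have n1 : ∀ p ∈ maximizers n P, ∀ q ∈ maximizers n P, inner ℝ n p = inner ℝ n q :=
      fun p hp q hq => inner_eq_of_mem_maximizers hp hq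
    have n2 : ∀ p ∈ maximizers (-n) P, ∀ q ∈ maximizers (-n) P, inner ℝ n p = inner ℝ n q :=
      fun p hp q hq => by simpa using inner_eq_of_mem_maximizers hp hq
    have p1 := germIndicator_planar h.neg_e cF (isClosed_maximizers hcl n) n1 hm y
    have p2 := germIndicator_planar h cF (isClosed_maximizers hcl n) n1 hm y
    have p3 := germIndicator_planar h.neg_e cF' (isClosed_maximizers hcl (-n)) n2 hm' y
    have p4 := germIndicator_planar h cF' (isClosed_maximizers hcl (-n)) n2 hm' y
    rw [h₀, h₁] at p1 p2
    rw [h₂, h₃] at p3 p4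
    have e1 := germIndicator_segment (a := a) h.e_ne y
    have e2 := germIndicator_segment (a := a + τ₁) h.e_ne y
    have e3 := germIndicator_segment (a := a + τ₂) h.e_ne y
    have e4 := germIndicator_segment (a := a + τ₁ + τ₂) h.e_ne y
    linear_combination s1 - s2 - s3 + s4 + p1 - p2 - p3 + p4 + e1 - e2 - e3 + e4
  have sum0 := Finset.sum_congr (rfl : L = L) fun lam _ =>
    congrArg ((Λ lam : ℤ) * ·) (key (x + a - lam))
  simp only [mul_add, mul_sub, Finset.sum_add_distrib, Finset.sum_sub_distrib] at sum0
  rw [tile h.neg_e.neg_m.neg_n, tile h.neg_e.neg_m, tile h.neg_e.neg_n, tile h.neg_e,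
    tile h.neg_m.neg_n, tile h.neg_m, tile h.neg_n, tile h] at sum0
  have mem0 : segment ℝ a (a + e) ⊆ P := h₀ ▸ fun p hp => hp.1.1
  have mem1 : segment ℝ (a + τ₁) (a + τ₁ + e) ⊆ P := h₁ ▸ fun p hp => hp.1.1
  have mem2 : segment ℝ (a + τ₂) (a + τ₂ + e) ⊆ P := h₂ ▸ fun p hp => hp.1.1
  have mem3 : segment ℝ (a + τ₁ + τ₂) (a + τ₁ + τ₂ + e) ⊆ P := h₃ ▸ fun p hp => hp.1.1
  rw [pick _ (mem0 (left_mem_segment ℝ _ _)), pick _ (mem0 (right_mem_segment ℝ _ _)),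
    pick _ (mem1 (left_mem_segment ℝ _ _)), pick _ (mem1 (right_mem_segment ℝ _ _)),
    pick _ (mem2 (left_mem_segment ℝ _ _)), pick _ (mem2 (right_mem_segment ℝ _ _)),
    pick _ (mem3 (left_mem_segment ℝ _ _)), pick _ (mem3 (right_mem_segment ℝ _ _))] at sum0
  have q0 : x + a - a = x := by abel
  have q1 : x + a - (a + e) = x - e := by abel
  have q2 : x + a - (a + τ₁) = x - τ₁ := by abel
  have q3 : x + a - (a + τ₁ + e) = x - e - τ₁ := by abel
  have q4 : x + a - (a + τ₂) = x - τ₂ := by abel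
  have q5 : x + a - (a + τ₂ + e) = x - e - τ₂ := by abel
  have q6 : x + a - (a + τ₁ + τ₂) = x - τ₁ - τ₂ := by abel
  have q7 : x + a - (a + τ₁ + τ₂ + e) = x - e - τ₁ - τ₂ := by abel
  rw [q0, q1, q2, q3, q4, q5, q6, q7] at sum0
  simp only [backwardDiff]
  linear_combination sum0

/-! ### The geometry of four-legged frames -/

/-- An exposed face is the set of maximizers of `⟨u, ·⟩` for some vector `u`. -/
lemma exists_eq_maximizers {P F : Set R3} (h : IsExposed ℝ P F) (hne : F.Nonempty) :
    ∃ u : R3, F = maximizers u P := by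
  obtain ⟨l, hl⟩ := h hne
  refine ⟨(InnerProductSpace.toDual ℝ R3).symm l, ?_⟩
  rw [hl]
  simp [maximizers, InnerProductSpace.toDual_symm_apply]

lemma ne_zero_of_finrank_vectorSpan_segment {a e : R3}
    (h : Module.finrank ℝ (vectorSpan ℝ (segment ℝ a (a + e))) = 1) : e ≠ 0 := by
  rintro rfl
  rw [add_zero, segment_same, vectorSpan_singleton] at h
  simp at h

lemma segment_add_eq_iff {a b e : R3} (he : e ≠ 0) :
    segment ℝ a (a + e) = segment ℝ b (b + e) ↔ a = b := by
  refine ⟨fun h => ?_, fun h => by rw [h]⟩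
  have h1 := maximizers_neg_segment (a := a) he
  rw [h, maximizers_neg_segment he] at h1
  exact (Set.singleton_injective h1).symm

lemma exists_sub_notMem_span {F : Set R3} (h : Module.finrank ℝ (vectorSpan ℝ F) = 2) (e : R3) :
    ∃ p ∈ F, ∃ q ∈ F, p - q ∉ Submodule.span ℝ {e} := by
  by_contra! hc
  have hle : vectorSpan ℝ F ≤ Submodule.span ℝ {e} := by
    rw [vectorSpan_def, Submodule.span_le]
    rintro _ ⟨p, hp, q, hq, rfl⟩
    exact hc p hp q hq
  have h1 := Submodule.finrank_mono hle
  have h2 := finrank_span_le_card (R := ℝ) ({e} : Set R3)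
  simp at h2
  omega

/-- An edge with direction `e` of a convex set `P` that lies on a planar face `F` of `P` with normal
`n` is one of the two extreme edges of `F` in the direction `± m` of the plane of `F` orthogonal to
`e`. -/
lemma segment_eq_maximizers {e m n : R3} (h : IsOrthogonalFrame e m n) {P F : Set R3} (hF : F ⊆ P)
    (hn : ∀ p ∈ F, ∀ q ∈ F, inner ℝ n p = inner ℝ n q)
    (hspan : ∃ p ∈ F, ∃ q ∈ F, p - q ∉ Submodule.span ℝ {e}) {a : R3}
    (hE : IsExposed ℝ P (segment ℝ a (a + e))) (hEF : segment ℝ a (a + e) ⊆ F) :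
    segment ℝ a (a + e) = maximizers m F ∨ segment ℝ a (a + e) = maximizers (-m) F := by
  obtain ⟨u, hu⟩ := exists_eq_maximizers hE ⟨a, left_mem_segment ℝ _ _⟩
  have ha : a ∈ maximizers u P := hu ▸ left_mem_segment ℝ a (a + e)
  have hae : a + e ∈ maximizers u P := hu ▸ right_mem_segment ℝ a (a + e)
  have hFu : segment ℝ a (a + e) = maximizers u F := by
    ext x
    constructor
    · intro hx
      have hx' : x ∈ maximizers u P := hu ▸ hx
      exact ⟨hEF hx, fun y hy => hx'.2 y (hF hy)⟩
    · intro hx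
      rw [hu]
      exact ⟨hF hx.1, fun y hy => (ha.2 y hy).trans (hx.2 a (hEF (left_mem_segment ℝ _ _)))⟩
  obtain ⟨c, b, d, hcbd⟩ := h.exists_coeffs u
  have hue : inner ℝ u e = 0 := by
    have := inner_eq_of_mem_maximizers ha hae
    rw [inner_add_right] at this
    linarith
  have hc0 : c = 0 := by
    rw [hcbd, inner_add_left, inner_add_left, inner_smul_left, inner_smul_left, inner_smul_left,
      real_inner_comm e m, real_inner_comm e n, h.em, h.en] at hue
    simpa [h.e_ne] using hue
  -- On `F`, the functional `⟨u, ·⟩` differs by a constant from `b ⟨m, ·⟩`.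
  have hin : ∀ p ∈ F, ∀ q ∈ F,
      (inner ℝ u p ≤ inner ℝ u q ↔ b * inner ℝ m p ≤ b * inner ℝ m q) := by
    intro p hp q hq
    rw [hcbd, hc0, zero_smul, zero_add, inner_add_left, inner_add_left, inner_smul_left,
      inner_smul_left, inner_smul_left, inner_smul_left, hn p hp q hq]
    simp
  rcases lt_trichotomy b 0 with hb | hb | hb
  · right
    rw [hFu]
    ext x
    refine and_congr_right fun hx => forall₂_congr fun y hy => ?_
    rw [hin y hy x hx, inner_neg_left, inner_neg_left, neg_le_neg_iff, mul_le_mul_left_of_neg hb]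
  · exfalso
    obtain ⟨p, hp, q, hq, hpq⟩ := hspan
    have hall : ∀ x ∈ F, x ∈ segment ℝ a (a + e) := fun x hx => by
      rw [hFu]
      exact ⟨hx, fun y hy => by rw [hin y hy x hx, hb]; simp⟩
    obtain ⟨t, ht⟩ := sub_mem_span_of_mem_segment (hall p hp) (hall q hq)
    exact hpq (ht ▸ Submodule.smul_mem _ _ (Submodule.mem_span_singleton_self e))
  · left
    rw [hFu]
    ext x
    refine and_congr_right fun hx => forall₂_congr fun y hy => ?_
    rw [hin y hy x hx, mul_le_mul_iff_of_pos_left hb]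

lemma exists_inner_ne_of_not_mem_span {e m n : R3} (h : IsOrthogonalFrame e m n)
    {F : Set R3} (hn : ∀ p ∈ F, ∀ q ∈ F, inner ℝ n p = inner ℝ n q)
    (hspan : ∃ p ∈ F, ∃ q ∈ F, p - q ∉ Submodule.span ℝ {e}) :
    ∃ p ∈ F, ∃ q ∈ F, inner ℝ m p ≠ inner ℝ m q := by
  obtain ⟨p, hp, q, hq, hpq⟩ := hspan
  refine ⟨p, hp, q, hq, fun hm => hpq ?_⟩
  obtain ⟨c, b, d, hcbd⟩ := h.exists_coeffs (p - q)
  have h1 : inner ℝ m (p - q) = 0 := by rw [inner_sub_right, hm, sub_self]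
  have h2 : inner ℝ n (p - q) = 0 := by rw [inner_sub_right, hn p hp q hq, sub_self]
  rw [hcbd, inner_add_right, inner_add_right, inner_smul_right, inner_smul_right,
    inner_smul_right, real_inner_comm e m, h.em, h.mn] at h1
  rw [hcbd, inner_add_right, inner_add_right, inner_smul_right, inner_smul_right,
    inner_smul_right, real_inner_comm e n, h.en, real_inner_comm m n, h.mn] at h2
  have hb : b = 0 := by simpa [h.m_ne] using h1
  have hd : d = 0 := by simpa [h.n_ne] using h2
  rw [hcbd, hb, hd]
  simpa using Submodule.smul_mem _ _ (Submodule.mem_span_singleton_self e)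

lemma inner_pointReflection (u c x : R3) :
    inner ℝ u (Equiv.pointReflection c x) = 2 * inner ℝ u c - inner ℝ u x := by
  simp only [Equiv.pointReflection_apply, vsub_eq_sub, vadd_eq_add, inner_add_right,
    inner_sub_right]
  ring

/-- A point reflection turns the top face in the direction `u` into the bottom face. -/
lemma pointReflection_image_maximizers (c u : R3) (C : Set R3) :
    Equiv.pointReflection c '' maximizers u C =
      maximizers (-u) (Equiv.pointReflection c '' C) := by
  ext x
  constructor
  · rintro ⟨y, hy, rfl⟩
    refine ⟨Set.mem_image_of_mem _ hy.1, ?_⟩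
    rintro _ ⟨z, hz, rfl⟩
    rw [inner_neg_left, inner_neg_left, inner_pointReflection, inner_pointReflection]
    linarith [hy.2 z hz]
  · rintro ⟨⟨y, hy, rfl⟩, hmax⟩
    refine Set.mem_image_of_mem _ ⟨hy, fun z hz => ?_⟩
    have := hmax _ (Set.mem_image_of_mem _ hz)
    rw [inner_neg_left, inner_neg_left, inner_pointReflection, inner_pointReflection] at this
    linarith

lemma pointReflection_image_segment (c a e : R3) :
    Equiv.pointReflection c '' segment ℝ a (a + e) =
      segment ℝ (c + c - a - e) (c + c - a - e + e) := by
  have := image_segment ℝ (AffineEquiv.pointReflection ℝ c : R3 →ᵃ[ℝ] R3) a (a + e)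
  have h1 : Equiv.pointReflection c (a + e) = c + c - a - e := by
    simp only [Equiv.pointReflection_apply, vsub_eq_sub, vadd_eq_add]; abel
  have h2 : Equiv.pointReflection c a = c + c - a - e + e := by
    simp only [Equiv.pointReflection_apply, vsub_eq_sub, vadd_eq_add]; abel
  rw [← h2, ← h1, segment_symm ℝ (Equiv.pointReflection c (a + e))]
  exact this

/-- Every four-legged frame `(e, τ₁, τ₂)` of a tile provides a difference equation for the
multiset of translations. -/
lemma IsFourLeggedFrame.backwardDiff_eq_zero {k : ℕ} (hk : 0 < k) {P : Set R3} {Λ : R3 → ℕ}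
    (hΛ : IsDiscreteMultiset Λ) (hT : TilesAtLevel k P Λ) (hc : Convex ℝ P) (hP : IsCompact P)
    {e τ₁ τ₂ : R3} (hf : IsFourLeggedFrame P e τ₁ τ₂) (x : R3) :
    backwardDiff e (backwardDiff τ₁ (backwardDiff τ₂ fun z => (Λ z : ℤ))) x = 0 := by
  obtain ⟨c, a, F, hsymm, ⟨hF0, hFexp, hF2⟩, hτ, ⟨-, hE₀, hdim⟩, ⟨-, hE₁, -⟩, ⟨-, hE₂, -⟩,
    ⟨-, hE₃, -⟩, i₀, i₁, i₂, i₃⟩ := hf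
  have he := ne_zero_of_finrank_vectorSpan_segment hdim
  have hint := hT.interior_nonempty hk hΛ hc hP.isClosed
  obtain ⟨n, rfl⟩ := exists_eq_maximizers hFexp hF0
  rw [pointReflection_image_maximizers, hsymm] at i₂ i₃
  have hspan := exists_sub_notMem_span hF2 e
  have hspan' : ∃ p ∈ maximizers (-n) P, ∃ q ∈ maximizers (-n) P,
      p - q ∉ Submodule.span ℝ {e} := by
    obtain ⟨p, hp, q, hq, hpq⟩ := hspan
    have himg := pointReflection_image_maximizers c n P
    rw [hsymm] at himg
    refine ⟨_, himg ▸ Set.mem_image_of_mem _ hp, _, himg ▸ Set.mem_image_of_mem _ hq, fun h => ?_⟩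
    apply hpq
    rw [← Submodule.neg_mem_iff] at h
    convert h using 1
    simp only [Equiv.pointReflection_apply, vsub_eq_sub, vadd_eq_add]
    abel
  -- The zero functional would expose `P` itself, which is not planar.
  have hn0 : n ≠ 0 := by
    rintro rfl
    have hFP : maximizers 0 P = P := by ext; simp [maximizers]
    have htop : affineSpan ℝ P = ⊤ := by
      rw [eq_top_iff, ← isOpen_interior.affineSpan_eq_top hint]
      exact affineSpan_mono ℝ interior_subset
    rw [hFP, ← direction_affineSpan, htop, AffineSubspace.direction_top] at hF2
    simp at hF2
  have hen : inner ℝ e n = 0 := by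
    have := inner_eq_of_mem_maximizers (i₀ (left_mem_segment ℝ _ _)) (i₀ (right_mem_segment ℝ _ _))
    rw [inner_add_right] at this
    rw [real_inner_comm]
    linarith
  have n1 : ∀ p ∈ maximizers n P, ∀ q ∈ maximizers n P, inner ℝ n p = inner ℝ n q :=
    fun p hp q hq => inner_eq_of_mem_maximizers hp hq
  have n2 : ∀ p ∈ maximizers (-n) P, ∀ q ∈ maximizers (-n) P, inner ℝ n p = inner ℝ n q :=
    fun p hp q hq => by simpa using inner_eq_of_mem_maximizers hp hq
  have s₁ : maximizers n P ⊆ P := fun p hp => hp.1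
  have s₂ : maximizers (-n) P ⊆ P := fun p hp => hp.1
  have hne01 : segment ℝ a (a + e) ≠ segment ℝ (a + τ₁) (a + τ₁ + e) := by
    rw [Ne, segment_add_eq_iff he]
    simpa using hτ
  have hne23 : segment ℝ (a + τ₂) (a + τ₂ + e) ≠
      segment ℝ (a + τ₁ + τ₂) (a + τ₁ + τ₂ + e) := by
    rw [Ne, segment_add_eq_iff he]
    simpa [add_right_comm] using hτ
  -- Choose the sign of `m` so that the first leg is extreme in the direction `m`.
  obtain ⟨m, h, h₀⟩ : ∃ m, IsOrthogonalFrame e m n ∧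
      segment ℝ a (a + e) = maximizers m (maximizers n P) := by
    obtain ⟨m, h⟩ := exists_isOrthogonalFrame he hn0 hen
    rcases segment_eq_maximizers h s₁ n1 hspan hE₀ i₀ with h₀ | h₀
    exacts [⟨m, h, h₀⟩, ⟨-m, h.neg_m, h₀⟩]
  have h₁ : segment ℝ (a + τ₁) (a + τ₁ + e) = maximizers (-m) (maximizers n P) :=
    (segment_eq_maximizers h s₁ n1 hspan hE₁ i₁).resolve_left fun h₁ => hne01 (h₀.trans h₁.symm)
  have hm := exists_inner_ne_of_not_mem_span h n1 hspan
  have hm' := exists_inner_ne_of_not_mem_span h n2 hspan'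
  have r₀ : segment ℝ (c + c - a - e) (c + c - a - e + e) =
      maximizers (-m) (maximizers (-n) P) := by
    rw [← pointReflection_image_segment, h₀, pointReflection_image_maximizers,
      pointReflection_image_maximizers, hsymm]
  have r₁ : segment ℝ (c + c - (a + τ₁) - e) (c + c - (a + τ₁) - e + e) =
      maximizers m (maximizers (-n) P) := by
    rw [← pointReflection_image_segment, h₁, pointReflection_image_maximizers,
      pointReflection_image_maximizers, hsymm, neg_neg]
  -- The reflection pairs the first leg with the fourth and the second with the third: otherwise
  -- `τ₁ = -τ₁`.
  rcases segment_eq_maximizers h s₂ n2 hspan' hE₂ i₂ with h₂ | h₂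
  · have h₃ := (segment_eq_maximizers h s₂ n2 hspan' hE₃ i₃).resolve_left
      fun h₃ => hne23 (h₂.trans h₃.symm)
    exact hT.backwardDiff_eq_zero hΛ hc hP h (exists_inner_ne_of_interior_nonempty hint hn0) hm hm'
      h₀.symm h₁.symm h₂.symm h₃.symm x
  · exfalso
    have h₃ := (segment_eq_maximizers h s₂ n2 hspan' hE₃ i₃).resolve_right
      fun h₃ => hne23 (h₂.trans h₃.symm)
    have t₀ := (segment_add_eq_iff he).1 (h₂.trans r₀.symm)
    have t₁ := (segment_add_eq_iff he).1 (h₃.trans r₁.symm)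
    have h2 : (2 : ℝ) • τ₁ = 0 := by
      have e1 : τ₂ = c + c - a - e - a := by rw [← t₀]; abel
      have e2 : τ₁ + τ₁ + τ₂ = c + c - a - e - a := by
        have : τ₁ + τ₁ + τ₂ = (a + τ₁ + τ₂) + τ₁ - a := by abel
        rw [this, t₁]; abel
      rw [two_smul, ← sub_eq_zero.2 (e2.trans e1.symm)]
      abel
    exact hτ ((smul_eq_zero.1 h2).resolve_left two_ne_zero)

/-! ### Temperate growth -/

lemma deltaMeasure_apply (Λ : R3 → ℕ) {s : Set R3} (hs : MeasurableSet s) :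
    deltaMeasure Λ s = ∑' lam : R3, (Λ lam : ℝ≥0∞) * s.indicator (fun _ => 1) lam := by
  rw [deltaMeasure, Measure.sum_apply _ hs]
  refine tsum_congr fun lam => ?_
  rw [Measure.smul_apply, Measure.dirac_apply' _ hs, smul_eq_mul]
  rfl

/-- The mass of `δ_Λ` is at most `k` on all balls of some fixed radius: the translates of a tile
with nonempty interior by the points of a small ball have a ball in common, which contains a point that
is covered exactly `k` times. -/
lemma TilesAtLevel.exists_deltaMeasure_ball_le {k : ℕ} {P : Set R3} {Λ : R3 → ℕ}
    (hT : TilesAtLevel k P Λ) (hP : (interior P).Nonempty) :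
    ∃ ρ > 0, ∀ z : R3, deltaMeasure Λ (Metric.ball z ρ) ≤ k := by
  obtain ⟨p, hp⟩ := hP
  obtain ⟨r, hr, hsub⟩ := Metric.isOpen_iff.1 isOpen_interior p hp
  refine ⟨r / 2, half_pos hr, fun z => ?_⟩
  obtain ⟨x, hxb, hx⟩ : ∃ x ∈ Metric.ball (z + p) (r / 2),
      ∑' lam : R3, (Λ lam : ℝ≥0∞) * (lam +ᵥ P).indicator (fun _ => (1 : ℝ≥0∞)) x = k := by
    by_contra! hc
    have h0 : volume (Metric.ball (z + p) (r / 2)) = 0 := measure_mono_null hc (ae_iff.1 hT)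
    exact (Metric.measure_ball_pos volume (z + p) (half_pos hr)).ne' h0
  rw [deltaMeasure_apply _ Metric.isOpen_ball.measurableSet, ← hx]
  refine ENNReal.tsum_le_tsum fun lam => ?_
  gcongr
  by_cases hlam : lam ∈ Metric.ball z (r / 2)
  · have hmem : x ∈ lam +ᵥ P := by
      rw [mem_vadd_set_iff_sub_mem]
      apply interior_subset (hsub _)
      rw [mem_ball_iff_norm] at hlam hxb ⊢
      calc ‖x - lam - p‖ = ‖(x - (z + p)) - (lam - z)‖ := by congr 1; abel
        _ ≤ ‖x - (z + p)‖ + ‖lam - z‖ := norm_sub_le _ _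
        _ < r := by linarith
    rw [Set.indicator_of_mem hmem, Set.indicator_of_mem hlam]
  · rw [Set.indicator_of_notMem hlam]
    exact zero_le

/-- A measure that is uniformly bounded on the balls of some fixed radius has temperate growth, by
comparison with Lebesgue measure. -/
lemma hasTemperateGrowth_of_ball_le {μ : Measure R3} {ρ : ℝ} (hρ : 0 < ρ) {k : ℝ≥0∞} (hk : k ≠ ∞)
    (h : ∀ z : R3, μ (Metric.ball z ρ) ≤ k) : μ.HasTemperateGrowth := by
  classical
  have : IsLocallyFiniteMeasure μ :=
    ⟨fun x => ⟨Metric.ball x ρ, Metric.ball_mem_nhds x hρ, (h x).trans_lt hk.lt_top⟩⟩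
  refine ⟨⟨4, ?_⟩⟩
  set f : R3 → ℝ := fun x => (1 + ‖x‖) ^ (-((4 : ℕ) : ℝ)) with hf
  have hint : Integrable f := by
    refine integrable_one_add_norm ?_
    simp only [finrank_euclideanSpace, Fintype.card_fin]
    norm_num
  have hf0 : ∀ x, 0 ≤ f x := fun x => by positivity
  have hfc : Continuous f := by
    refine Continuous.rpow_const (by fun_prop) fun x => Or.inl ?_
    positivity
  set F : R3 → ℝ≥0∞ := fun x => ENNReal.ofReal (f x) with hF
  have hFm : Measurable F := (ENNReal.continuous_ofReal.comp hfc).measurable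
  have hfin : ∫⁻ x, F x ≠ ∞ := by
    have := hint.lintegral_lt_top
    exact this.ne
  set C : ℝ≥0∞ := ENNReal.ofReal ((1 + ρ) ^ (4 : ℕ)) with hC
  have hcomp : ∀ lam x : R3, x ∈ Metric.ball lam ρ → F lam ≤ C * F x := by
    intro lam x hx
    rw [hC, hF, ← ENNReal.ofReal_mul (by positivity)]
    refine ENNReal.ofReal_le_ofReal ?_
    simp only [hf]
    rw [Real.rpow_neg (by positivity), Real.rpow_neg (by positivity), Real.rpow_natCast,
      Real.rpow_natCast, ← div_eq_mul_inv, inv_eq_one_div,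
      div_le_div_iff₀ (by positivity) (by positivity), one_mul, ← mul_pow]
    refine pow_le_pow_left₀ (by positivity) ?_ 4
    rw [mem_ball_iff_norm] at hx
    have h1 : ‖x‖ ≤ ‖x - lam‖ + ‖lam‖ := by simpa using norm_add_le (x - lam) lam
    nlinarith [norm_nonneg lam]
  set v := volume (Metric.ball (0 : R3) ρ) with hv
  have hv0 : v ≠ 0 := (Metric.measure_ball_pos volume _ hρ).ne'
  set S : Set (R3 × R3) := {q | dist q.2 q.1 < ρ} with hS
  have hSm : MeasurableSet S :=
    (isOpen_lt (by fun_prop) continuous_const).measurableSet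
  have hb : ∀ lam, F lam * v ≤ ∫⁻ x, S.indicator (fun q => C * F q.2) (lam, x) := by
    intro lam
    calc F lam * v = ∫⁻ x in Metric.ball lam ρ, F lam := by
          rw [setLIntegral_const, hv, Measure.addHaar_ball_center volume lam]
      _ ≤ ∫⁻ x in Metric.ball lam ρ, C * F x :=
          setLIntegral_mono (by fun_prop) fun x hx => hcomp lam x hx
      _ = _ := by
          rw [← lintegral_indicator Metric.isOpen_ball.measurableSet]
          rfl
  have hswap : (∫⁻ lam, F lam ∂μ) * v ≤ C * k * ∫⁻ x, F x := by
    calc (∫⁻ lam, F lam ∂μ) * v = ∫⁻ lam, F lam * v ∂μ := (lintegral_mul_const _ hFm).symm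
      _ ≤ ∫⁻ lam, (∫⁻ x, S.indicator (fun q => C * F q.2) (lam, x)) ∂μ := lintegral_mono hb
      _ = ∫⁻ x, (∫⁻ lam, S.indicator (fun q => C * F q.2) (lam, x) ∂μ) := by
          refine lintegral_lintegral_swap ?_
          exact (Measurable.indicator (by fun_prop) hSm).aemeasurable
      _ = ∫⁻ x, C * F x * μ (Metric.ball x ρ) := by
          refine lintegral_congr fun x => ?_
          rw [← setLIntegral_const, ← lintegral_indicator Metric.isOpen_ball.measurableSet]
          refine lintegral_congr fun lam => ?_
          simp only [Set.indicator_apply, hS, Set.mem_ofPred_eq, Metric.mem_ball, dist_comm x lam]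
      _ ≤ ∫⁻ x, C * k * F x := by
          refine lintegral_mono fun x => ?_
          calc C * F x * μ (Metric.ball x ρ) ≤ C * F x * k := by gcongr; exact h x
            _ = C * k * F x := by ring
      _ = _ := lintegral_const_mul _ hFm
  refine ⟨hfc.aestronglyMeasurable, ?_⟩
  rw [hasFiniteIntegral_iff_ofReal (Eventually.of_forall hf0)]
  have h1 : (∫⁻ lam, F lam ∂μ) * v < ∞ :=
    hswap.trans_lt (ENNReal.mul_lt_top
      (ENNReal.mul_lt_top ENNReal.ofReal_lt_top hk.lt_top) hfin.lt_top)
  exact ENNReal.lt_top_of_mul_ne_top_left h1.ne hv0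

/-! ### Difference equations and the support of the Fourier transform -/

/-- The factor `1 - e^{-2πi⟨v, ξ⟩}` by which the Fourier transform turns the backward difference
operator with step `v` into a multiplication operator. -/
noncomputable def diffSymbol (v : R3) (ξ : R3) : ℂ :=
  1 - Complex.exp (-(2 * Real.pi * (inner ℝ v ξ : ℝ) * Complex.I))

lemma contDiff_diffSymbol (v : R3) : ContDiff ℝ ⊤ (diffSymbol v) := by
  have h : ContDiff ℝ ⊤ fun ξ : R3 => ((inner ℝ v ξ : ℝ) : ℂ) :=
    Complex.ofRealCLM.contDiff.comp (contDiff_const.inner ℝ contDiff_id)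
  exact contDiff_const.sub
    (Complex.contDiff_exp.comp (((contDiff_const.mul h).mul contDiff_const).neg))

lemma exists_int_of_diffSymbol_eq_zero {v ξ : R3} (h : diffSymbol v ξ = 0) :
    ∃ n : ℤ, inner ℝ v ξ = n := by
  rw [diffSymbol, sub_eq_zero, eq_comm, Complex.exp_eq_one_iff] at h
  obtain ⟨n, hn⟩ := h
  refine ⟨-n, ?_⟩
  have h2 : (2 * Real.pi * Complex.I : ℂ) ≠ 0 := Complex.two_pi_I_ne_zero
  have : ((inner ℝ v ξ : ℝ) : ℂ) = ((-n : ℤ) : ℝ) := by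
    apply mul_left_cancel₀ h2
    push_cast
    linear_combination -hn
  exact_mod_cast this

lemma fourier_diffSymbol_mul {v : R3} {φ ψ : 𝓢(R3, ℂ)} (h : ∀ ξ, φ ξ = diffSymbol v ξ * ψ ξ)
    (x : R3) : (𝓕 φ) x = (𝓕 ψ) x - (𝓕 ψ) (x + v) := by
  simp only [fourier_coe, Real.fourier_eq]
  rw [← integral_sub]
  · refine integral_congr_ae (Eventually.of_forall fun ξ => ?_)
    simp only [Circle.smul_def, Real.fourierChar_apply, smul_eq_mul, h, diffSymbol,
      inner_add_right, real_inner_comm ξ v]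
    rw [mul_sub_right_distrib, mul_sub, one_mul, ← mul_assoc, ← Complex.exp_add]
    congr 4
    push_cast
    ring
  · exact (Real.fourierIntegral_convergent_iff x).2 ψ.integrable
  · exact (Real.fourierIntegral_convergent_iff (x + v)).2 ψ.integrable

/-- A function on `ℝ³` can be paired with Schwartz functions if all the sums `∑ f(x) g(x)`
converge. -/
def SchwartzSummable (f : R3 → ℤ) : Prop :=
  ∀ g : 𝓢(R3, ℂ), Summable fun x => (f x : ℂ) * g x

lemma SchwartzSummable.comp_sub {f : R3 → ℤ} (hf : SchwartzSummable f) (v : R3) :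
    SchwartzSummable fun x => f (x - v) := by
  intro g
  have := hf (g.compSubConstCLM ℂ (-v))
  simp only [compSubConstCLM_apply, sub_neg_eq_add] at this
  rw [← (Equiv.subRight v).summable_iff] at this
  simpa [Function.comp_def] using this

lemma SchwartzSummable.backwardDiff {f : R3 → ℤ} (hf : SchwartzSummable f) (v : R3) :
    SchwartzSummable (backwardDiff v f) := by
  intro g
  have := (hf g).sub (hf.comp_sub v g)
  simpa [MultiTiling.backwardDiff, sub_mul] using this

/-- Summation by parts. -/
lemma SchwartzSummable.tsum_fourier {f : R3 → ℤ} (hf : SchwartzSummable f) {v : R3}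
    {φ ψ : 𝓢(R3, ℂ)} (h : ∀ ξ, φ ξ = diffSymbol v ξ * ψ ξ) :
    ∑' x, (f x : ℂ) * (𝓕 φ) x = ∑' x, (MultiTiling.backwardDiff v f x : ℂ) * (𝓕 ψ) x := by
  have h1 : Summable fun x => (f x : ℂ) * (𝓕 ψ) (x + v) := by
    have := hf ((𝓕 ψ).compSubConstCLM ℂ (-v))
    simpa only [compSubConstCLM_apply, sub_neg_eq_add] using this
  simp only [fourier_diffSymbol_mul h, mul_sub, MultiTiling.backwardDiff, Int.cast_sub, sub_mul]
  have h2 := (Equiv.subRight v).tsum_eq fun x => (f x : ℂ) * (𝓕 ψ) (x + v)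
  simp only [Equiv.subRight_apply, sub_add_cancel] at h2
  rw [(hf _).tsum_sub h1, (hf _).tsum_sub (hf.comp_sub v _), ← h2]

lemma schwartzSummable_of_hasTemperateGrowth {Λ : R3 → ℕ} [(deltaMeasure Λ).HasTemperateGrowth] :
    SchwartzSummable fun x => (Λ x : ℤ) := by
  intro g
  have := (hasSum_integral_measure (g.integrable (μ := deltaMeasure Λ))).summable
  simpa using this

lemma fourier_deltaMeasure_apply {Λ : R3 → ℕ} [(deltaMeasure Λ).HasTemperateGrowth]
    (φ : 𝓢(R3, ℂ)) :
    (𝓕 (deltaMeasure Λ).toTemperedDistribution : 𝓢'(R3, ℂ)) φ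
      = ∑' x, (((Λ x : ℕ) : ℤ) : ℂ) * (𝓕 φ) x := by
  rw [TemperedDistribution.fourier_apply,
    Measure.toTemperedDistribution_apply (μ := deltaMeasure Λ)]
  have := (hasSum_integral_measure ((𝓕 φ).integrable (μ := deltaMeasure Λ))).tsum_eq
  rw [deltaMeasure, ← this]
  simp

/-- Division of a compactly supported test function by a smooth function without zeros on its
support. -/
lemma exists_schwartz_eq_mul {u : 𝓢(R3, ℂ)} (hu : HasCompactSupport u) {A : R3 → ℂ}
    (hA : ContDiff ℝ ⊤ A) (h0 : ∀ ξ ∈ tsupport u, A ξ ≠ 0) :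
    ∃ ψ : 𝓢(R3, ℂ), (∀ ξ, u ξ = A ξ * ψ ξ) ∧ tsupport ψ ⊆ tsupport u := by
  have hsub : Function.support (fun ξ => u ξ / A ξ) ⊆ tsupport u := by
    intro ξ hξ
    refine subset_tsupport u fun h => hξ ?_
    simp [h]
  have hcs : HasCompactSupport fun ξ => u ξ / A ξ := hu.mono' hsub
  have hcd : ContDiff ℝ (⊤ : ℕ∞) fun ξ => u ξ / A ξ := by
    rw [contDiff_iff_contDiffAt]
    intro ξ
    by_cases hξ : ξ ∈ tsupport u
    · simp only [div_eq_mul_inv]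
      exact u.smooth'.contDiffAt.mul ((hA.of_le le_top).contDiffAt.inv (h0 ξ hξ))
    · have h1 : (fun ξ => u ξ / A ξ) =ᶠ[𝓝 ξ] fun _ => 0 := by
        filter_upwards [notMem_tsupport_iff_eventuallyEq.1 hξ] with η hη
        simp [hη]
      exact contDiffAt_const.congr_of_eventuallyEq h1
  refine ⟨hcs.toSchwartzMap hcd, fun ξ => ?_, ?_⟩
  · simp only [HasCompactSupport.toSchwartzMap_toFun]
    by_cases hξ : ξ ∈ tsupport u
    · rw [mul_div_cancel₀ _ (h0 ξ hξ)]
    · simp [image_eq_zero_of_notMem_tsupport hξ]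
  · exact closure_minimal hsub (isClosed_tsupport u)

/-- If `Λ` is annihilated by the differences with steps `v₁, v₂, v₃`, then the Fourier transform
of `δ_Λ` is supported on the zeros of the product of the symbols. -/
lemma exists_int_of_mem_fourierSupport {Λ : R3 → ℕ} [(deltaMeasure Λ).HasTemperateGrowth]
    {v₁ v₂ v₃ : R3}
    (h : ∀ x, backwardDiff v₁ (backwardDiff v₂ (backwardDiff v₃ fun z => (Λ z : ℤ))) x = 0)
    {ξ : R3} (hξ : ξ ∈ fourierSupport Λ) :
    (∃ n : ℤ, inner ℝ v₁ ξ = n) ∨ (∃ n : ℤ, inner ℝ v₂ ξ = n) ∨ ∃ n : ℤ, inner ℝ v₃ ξ = n := by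
  by_contra! hc
  obtain ⟨c₁, c₂, c₃⟩ := hc
  have d : ∀ {v : R3}, (∀ n : ℤ, inner ℝ v ξ ≠ n) → ∀ᶠ η in 𝓝 ξ, diffSymbol v η ≠ 0 := by
    intro v hv
    refine (contDiff_diffSymbol v).continuous.continuousAt.eventually_ne fun h0 => ?_
    obtain ⟨n, hn⟩ := exists_int_of_diffSymbol_eq_zero h0
    exact hv n hn
  obtain ⟨r, hr, hball⟩ := Metric.nhds_basis_closedBall.eventually_iff.1
    ((d c₁).and ((d c₂).and (d c₃)))
  refine (Distribution.notMem_dsupport_iff ξ).2 ⟨Metric.ball ξ r, fun u hu => ?_,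
    Metric.isOpen_ball, Metric.mem_ball_self hr⟩ hξ
  have hu' : tsupport u ⊆ Metric.closedBall ξ r := hu.trans Metric.ball_subset_closedBall
  have hcu : HasCompactSupport u :=
    (isCompact_closedBall ξ r).of_isClosed_subset (isClosed_tsupport u) hu'
  obtain ⟨ψ₃, e₃, s₃⟩ := exists_schwartz_eq_mul hcu (contDiff_diffSymbol v₃)
    fun η hη => (hball (hu' hη)).2.2
  have hc₃ : HasCompactSupport ψ₃ := hcu.isCompact.of_isClosed_subset (isClosed_tsupport _) s₃
  obtain ⟨ψ₂, e₂, s₂⟩ := exists_schwartz_eq_mul hc₃ (contDiff_diffSymbol v₂)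
    fun η hη => (hball (hu' (s₃ hη))).2.1
  have hc₂ : HasCompactSupport ψ₂ := hc₃.isCompact.of_isClosed_subset (isClosed_tsupport _) s₂
  obtain ⟨ψ₁, e₁, -⟩ := exists_schwartz_eq_mul hc₂ (contDiff_diffSymbol v₁)
    fun η hη => (hball (hu' (s₃ (s₂ hη)))).1
  have hΛ := schwartzSummable_of_hasTemperateGrowth (Λ := Λ)
  rw [fourier_deltaMeasure_apply, hΛ.tsum_fourier e₃, (hΛ.backwardDiff v₃).tsum_fourier e₂,
    ((hΛ.backwardDiff v₃).backwardDiff v₂).tsum_fourier e₁]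
  simp [h]

/-! ### Bounded density -/

lemma HasBoundedDensity.mono {S T : Set R3} (hT : HasBoundedDensity T) (h : S ⊆ T) :
    HasBoundedDensity S := by
  obtain ⟨M, hM⟩ := hT
  refine ⟨M, fun x R hR => le_trans ?_ (hM x R hR)⟩
  exact_mod_cast Set.encard_le_encard (Set.inter_subset_inter_left _ h)

lemma HasBoundedDensity.union {S T : Set R3} (hS : HasBoundedDensity S)
    (hT : HasBoundedDensity T) : HasBoundedDensity (S ∪ T) := by
  obtain ⟨M, hM⟩ := hS
  obtain ⟨N, hN⟩ := hT
  refine ⟨M + N, fun x R hR => ?_⟩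
  have h1 : ((S ∪ T) ∩ Metric.ball x R).encard ≤
      (S ∩ Metric.ball x R).encard + (T ∩ Metric.ball x R).encard := by
    rw [Set.union_inter_distrib_right]
    exact Set.encard_union_le _ _
  calc (((S ∪ T) ∩ Metric.ball x R).encard : ℝ≥0∞)
      ≤ (((S ∩ Metric.ball x R).encard + (T ∩ Metric.ball x R).encard : ℕ∞) : ℝ≥0∞) := by
        exact_mod_cast h1
    _ ≤ M * volume (Metric.ball x R) + N * volume (Metric.ball x R) := by
        push_cast
        exact add_le_add (hM x R hR) (hN x R hR)
    _ = _ := by push_cast; ring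

lemma HasBoundedDensity.iUnion {ι : Type*} [Finite ι] {S : ι → Set R3}
    (h : ∀ i, HasBoundedDensity (S i)) : HasBoundedDensity (⋃ i, S i) := by
  have key : ∀ t : Set ι, t.Finite → HasBoundedDensity (⋃ i ∈ t, S i) := by
    intro t ht
    induction t, ht using Set.Finite.induction_on with
    | empty => exact ⟨0, by simp⟩
    | insert _ _ ih =>
      rw [Set.biUnion_insert]
      exact (h _).union ih
  simpa using key Set.univ Set.finite_univ

/-- A uniformly discrete set has bounded density, by comparing volumes. -/
lemma hasBoundedDensity_of_separated {S : Set R3} {δ : ℝ} (hδ : 0 < δ)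
    (h : ∀ x ∈ S, ∀ y ∈ S, x ≠ y → δ ≤ dist x y) : HasBoundedDensity S := by
  set M : ℝ := (1 + δ / 2) ^ 3 / (δ / 2) ^ 3 with hM
  have hM0 : 0 ≤ M := by positivity
  set ω := volume (Metric.ball (0 : R3) 1) with hω
  have hω0 : ω ≠ 0 := (Metric.measure_ball_pos volume _ one_pos).ne'
  have hωt : ω ≠ ∞ := measure_ball_lt_top.ne
  have hωpos : 0 < ω.toReal := ENNReal.toReal_pos hω0 hωt
  refine ⟨(M / ω.toReal).toNNReal, fun x R hR => ?_⟩
  have vol : ∀ (y : R3) {r : ℝ}, 0 ≤ r → volume (Metric.ball y r) = ENNReal.ofReal (r ^ 3) * ω := by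
    intro y r hr
    rw [Measure.addHaar_ball volume y hr]
    simp [hω]
  have hfin : ∀ t : Finset R3, (t : Set R3) ⊆ S ∩ Metric.ball x R → (t.card : ℝ) ≤ M * R ^ 3 := by
    intro t ht
    have h1 : ∑ y ∈ t, volume (Metric.ball y (δ / 2)) ≤ volume (Metric.ball x (R + δ / 2)) := by
      rw [← measure_biUnion_finset]
      · refine measure_mono (Set.iUnion₂_subset fun y hy => Metric.ball_subset_ball' ?_)
        have := Metric.mem_ball.1 (ht hy).2
        linarith
      · intro y hy z hz hyz
        refine Metric.ball_disjoint_ball ?_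
        have := h y (ht hy).1 z (ht hz).1 hyz
        linarith
      · exact fun y _ => Metric.isOpen_ball.measurableSet
    simp only [vol _ (half_pos hδ).le, vol x (show 0 ≤ R + δ / 2 by linarith), Finset.sum_const,
      nsmul_eq_mul] at h1
    rw [← mul_assoc, ENNReal.mul_le_mul_iff_left hω0 hωt, ← ENNReal.ofReal_natCast,
      ← ENNReal.ofReal_mul (by positivity), ENNReal.ofReal_le_ofReal_iff (by positivity)] at h1
    have h2 : R + δ / 2 ≤ (1 + δ / 2) * R := by nlinarith
    have h3 : (R + δ / 2) ^ 3 ≤ ((1 + δ / 2) * R) ^ 3 := by gcongr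
    rw [hM, div_mul_eq_mul_div, le_div_iff₀ (by positivity)]
    rw [mul_pow] at h3
    exact h1.trans h3
  have hf : (S ∩ Metric.ball x R).Finite := by
    by_contra hinf
    obtain ⟨N, hN⟩ := exists_nat_gt (M * R ^ 3)
    obtain ⟨t, ht, hcard⟩ := Set.Infinite.exists_subset_card_eq hinf N
    have := hfin t ht
    rw [hcard] at this
    linarith
  have hle := hfin hf.toFinset (by simp)
  have hR0 : 0 < R := by linarith
  have hvol : volume (Metric.ball x R) = ENNReal.ofReal (R ^ 3 * ω.toReal) := by
    rw [vol x hR0.le, ENNReal.ofReal_mul (by positivity), ENNReal.ofReal_toReal hωt]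
  rw [hvol, hf.encard_eq_coe_toFinset_card]
  change _ ≤ ENNReal.ofReal (M / ω.toReal) * _
  rw [← ENNReal.ofReal_mul (by positivity), ENat.toENNReal_coe, ← ENNReal.ofReal_natCast]
  refine ENNReal.ofReal_le_ofReal (hle.trans_eq ?_)
  field_simp

lemma HasBoundedDensity.finite_inter_ball {S : Set R3} (hS : HasBoundedDensity S) (x : R3) :
    (S ∩ Metric.ball x 2).Finite := by
  obtain ⟨M, hM⟩ := hS
  have h1 := hM x 2 one_lt_two
  have h2 : (M : ℝ≥0∞) * volume (Metric.ball x 2) < ∞ :=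
    ENNReal.mul_lt_top ENNReal.coe_lt_top measure_ball_lt_top
  rw [← Set.encard_lt_top_iff]
  exact_mod_cast h1.trans_lt h2

lemma HasBoundedDensity.isDiscrete {S : Set R3} (hS : HasBoundedDensity S) : IsDiscrete S := by
  rw [isDiscrete_iff_forall_mem_exists_isOpen]
  intro y hy
  refine ⟨Metric.ball y 2 \ ((S ∩ Metric.ball y 2) \ {y}),
    Metric.isOpen_ball.sdiff ((hS.finite_inter_ball y).subset Set.sdiff_subset).isClosed, ?_⟩
  ext z
  simp only [Set.mem_inter_iff, Set.mem_sdiff, Set.mem_singleton_iff]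
  constructor
  · rintro ⟨⟨hz, hn⟩, hzS⟩
    by_contra hne
    exact hn ⟨⟨hzS, hz⟩, hne⟩
  · rintro rfl
    exact ⟨⟨Metric.mem_ball_self two_pos, fun h => h.2 rfl⟩, hy⟩

/-- The points at which finitely many linear functionals without common zeros take integer values
form a set of bounded density. -/
lemma hasBoundedDensity_of_inner_int {ι : Type*} [Fintype ι] (V : ι → R3)
    (hV : ∀ y : R3, (∀ i, inner ℝ (V i) y = 0) → y = 0) :
    HasBoundedDensity {ξ | ∀ i, ∃ n : ℤ, inner ℝ (V i) ξ = n} := by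
  have hpos : 0 < 1 + ∑ i, ‖V i‖ := by positivity
  refine hasBoundedDensity_of_separated (δ := 1 / (1 + ∑ i, ‖V i‖)) (by positivity) ?_
  intro x hx y hy hxy
  obtain ⟨i, hi⟩ : ∃ i, inner ℝ (V i) (x - y) ≠ 0 := by
    by_contra! hc
    exact hxy (sub_eq_zero.1 (hV _ hc))
  obtain ⟨p, hp⟩ := hx i
  obtain ⟨q, hq⟩ := hy i
  have h1 : (1 : ℝ) ≤ |inner ℝ (V i) (x - y)| := by
    rw [inner_sub_right, hp, hq] at hi ⊢
    have : p - q ≠ 0 := fun h => hi (by exact_mod_cast h)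
    exact_mod_cast Int.one_le_abs this
  have h2 : ‖V i‖ ≤ 1 + ∑ i, ‖V i‖ := by
    have := Finset.single_le_sum (f := fun i => ‖V i‖) (fun i _ => norm_nonneg _)
      (Finset.mem_univ i)
    linarith
  rw [div_le_iff₀ hpos, dist_eq_norm]
  calc (1 : ℝ) ≤ ‖V i‖ * ‖x - y‖ := h1.trans (abs_real_inner_le_norm _ _)
    _ ≤ (1 + ∑ i, ‖V i‖) * ‖x - y‖ := by gcongr
    _ = _ := mul_comm _ _

lemma isClosed_perp (v : R3) : IsClosed (perp v) :=
  isClosed_eq (by fun_prop) continuous_const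

/-- By compactness of the unit sphere, the intersection property is witnessed by finitely many
four-legged frames. -/
lemma IntersectionProperty.exists_finset {P : Set R3} (hI : IntersectionProperty P) :
    ∃ u : Finset {t : R3 × R3 × R3 // IsFourLeggedFrame P t.1 t.2.1 t.2.2},
      ∀ y : R3, (∀ t ∈ u, y ∈ perp t.1.1 ∪ perp t.1.2.1 ∪ perp t.1.2.2) → y = 0 := by
  obtain ⟨u, hu⟩ := (isCompact_sphere (0 : R3) 1).elim_finite_subfamily_closed
    (fun t : {t : R3 × R3 × R3 // IsFourLeggedFrame P t.1 t.2.1 t.2.2} =>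
      perp t.1.1 ∪ perp t.1.2.1 ∪ perp t.1.2.2)
    (fun t => ((isClosed_perp _).union (isClosed_perp _)).union (isClosed_perp _)) (by
      ext y
      simp only [Set.mem_inter_iff, mem_sphere_zero_iff_norm, Set.mem_iInter,
        Set.mem_empty_iff_false, iff_false, not_and]
      intro hy hall
      have : y ∈ ({0} : Set R3) := by
        rw [← hI]
        simp only [Set.mem_iInter]
        exact fun e τ₁ τ₂ hf => hall ⟨(e, τ₁, τ₂), hf⟩
      rw [Set.mem_singleton_iff.1 this, norm_zero] at hy
      exact zero_ne_one hy)
  refine ⟨u, fun y hy => ?_⟩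
  by_contra hy0
  have hmem : ‖y‖⁻¹ • y ∈ Metric.sphere (0 : R3) 1 ∩ ⋂ t ∈ u,
      perp t.1.1 ∪ perp t.1.2.1 ∪ perp t.1.2.2 := by
    refine ⟨by simp [norm_smul, hy0], ?_⟩
    simp only [Set.mem_iInter]
    intro t ht
    have scale : ∀ v : R3, y ∈ perp v → ‖y‖⁻¹ • y ∈ perp v := fun v hv => by
      have hv : inner ℝ v y = 0 := hv
      change inner ℝ v (‖y‖⁻¹ • y) = 0
      rw [inner_smul_right, hv, mul_zero]
    exact (hy t ht).imp (Or.imp (scale _) (scale _)) (scale _)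
  rw [hu] at hmem
  exact hmem

lemma hasBoundedDensity_of_intersectionProperty {P S : Set R3} (hI : IntersectionProperty P)
    (hS : ∀ e τ₁ τ₂, IsFourLeggedFrame P e τ₁ τ₂ → ∀ ξ ∈ S,
      (∃ n : ℤ, inner ℝ e ξ = n) ∨ (∃ n : ℤ, inner ℝ τ₁ ξ = n) ∨ ∃ n : ℤ, inner ℝ τ₂ ξ = n) :
    HasBoundedDensity S := by
  classical
  obtain ⟨u, hu⟩ := hI.exists_finset
  -- `V t j` is the `j`-th vector of the frame `t`; a function `f` selects one vector per frame.
  let V : u → Fin 3 → R3 := fun t => ![t.1.1.1, t.1.1.2.1, t.1.1.2.2]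
  refine (HasBoundedDensity.iUnion fun f : u → Fin 3 =>
    hasBoundedDensity_of_inner_int (fun t => V t (f t)) fun y hy => hu y fun t ht => ?_).mono ?_
  · have h1 : inner ℝ (V ⟨t, ht⟩ (f ⟨t, ht⟩)) y = 0 := hy ⟨t, ht⟩
    generalize f ⟨t, ht⟩ = j at h1
    fin_cases j
    exacts [Or.inl (Or.inl h1), Or.inl (Or.inr h1), Or.inr h1]
  · intro ξ hξ
    have : ∀ t : u, ∃ j : Fin 3, ∃ n : ℤ, inner ℝ (V t j) ξ = n := fun t => by
      rcases hS _ _ _ t.1.2 ξ hξ with h | h | h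
      exacts [⟨0, h⟩, ⟨1, h⟩, ⟨2, h⟩]
    choose f hf using this
    exact Set.mem_iUnion.2 ⟨f, hf⟩

end MultiTiling

theorem mainTheorem6 (k : ℕ) (hk : 0 < k) (P : Set MultiTiling.R3)
    (hP : MultiTiling.IsConvexPolytope P) (Λ : MultiTiling.R3 → ℕ)
    (hΛ : MultiTiling.IsDiscreteMultiset Λ) (hT : MultiTiling.TilesAtLevel k P Λ)
    (hI : MultiTiling.IntersectionProperty P) :
    ∃ _ : (MultiTiling.deltaMeasure Λ).HasTemperateGrowth,
      IsDiscrete (MultiTiling.fourierSupport Λ) ∧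
      MultiTiling.HasBoundedDensity (MultiTiling.fourierSupport Λ) := by
  obtain ⟨s, rfl⟩ := hP
  have hc := convex_convexHull ℝ (s : Set MultiTiling.R3)
  have hK := s.finite_toSet.isCompact_convexHull ℝ
  obtain ⟨ρ, hρ, hball⟩ :=
    hT.exists_deltaMeasure_ball_le (hT.interior_nonempty hk hΛ hc hK.isClosed)
  have hμ := MultiTiling.hasTemperateGrowth_of_ball_le hρ (ENNReal.natCast_ne_top k) hball
  have hS := MultiTiling.hasBoundedDensity_of_intersectionProperty
    (S := MultiTiling.fourierSupport Λ) hI fun e τ₁ τ₂ hf ξ hξ =>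
      MultiTiling.exists_int_of_mem_fourierSupport (hf.backwardDiff_eq_zero hk hΛ hT hc hK) hξ
  exact ⟨hμ, hS.isDiscrete, hS⟩
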